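/- **Conventions.** Let $K$ be a field. A dg-algebra over $K$ is a $\mathbb Z$-graded $K$-algebra $A$ with a $K$-linear map $d_A:A\to A$ of degree $1$ such that $d_A^2=0$ and $d_A(ab)=d_A(a)b+(-1)^{|a|}a\,d_A(b)$ for homogeneous $a,b$. It is acyclic if $\ker d_A=\operatorname{im} d_A$, and graded commutative if $ab=(-1)^{|a||b|}ba$ for homogeneous $a,b$. A dg-division algebra is a nonzero dg-algebra whose only homogeneous $d$-stable left ideals, and whose only homogeneous $d$-stable right ideals, are $0$ and $A$. A gr-division ring is a nonzero $\mathbb Z$-graded ring in which every nonzero homogeneous element is invertible. A dg-extension is a $K$-algebra homomorphism of degree $0$ that commutes with the differentials. An extension $R\to S$ of algebras (graded algebras, dg-algebras) is separable (graded-separable, dg-separable) if the multiplication map $S\otimes_R S\to S$ has a right inverse that is a homomorphism of $S$-$S$-bimodules (graded bimodules, dg-bimodules). Here $S\otimes_RS$ has the total grading and, in the dg case, the differential $x\otimes y\mapsto d(x)\otimes y+(-1)^{|x|}x\otimes d(y)$. **Theorem.** Let $K$ be a field, let $(A,d_A)$ and $(B,d_B)$ be graded commutative dg-division algebras over $K$,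 and let $\varphi:(B,d_B)\to(A,d_A)$ be a dg-extension. 1. The algebras $\ker(d_A)$ and $\ker(d_B)$ are graded-commutative gr-division rings. 2. If $(B,d_B)$ is acyclic, then $(A,d_A)$ is acyclic, and * $\varphi$ is dg-separable if the induced graded extension $\ker(d_B)\to\ker(d_A)$ is graded-separable; * if $\operatorname{char}K\neq2$, then $\varphi$ is dg-separable if and only if the induced graded extension $\ker(d_B)\to\ker(d_A)$ is graded-separable. 3. If $\operatorname{char}K\ne2$, $d_B=0$ and $(A,d_A)$ is acyclic, then $\varphi$ is not dg-separable. 4. If $\operatorname{char}K\neq2$ and $C$ is a $\mathbb Z$-graded $K$-algebra that is a graded-commutative gr-division ring, then either $C$ is a field concentrated in degree $0$, or there are a field $D$ containing $K$ and an isomorphism $C\cong D[T,T^{-1}]$ of graded $K$-algebras, with $D$ in degree $0$ and $T$ in a nonzero even degree. 5. Let $D_1\subseteq D_2$ be fields (of any characteristic) and let $n$ be a nonzero integer. Grade $D_2[T,T^{-1}]$ with $D_2$ in degree $0$ and $T$ in a nonzero degree. Then the extension $D_1[T^n,T^{-n}]\subseteq D_2[T,T^{-1}]$ is graded-separable if and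 only if the extension $D_1\subseteq D_2$ is separable (in the sense above, that is, $D_2\otimes_{D_1}D_2\to D_2$ splits as a map of bimodules) and $n$ is invertible in $D_1$. -/

import Mathlib

open scoped TensorProduct LaurentPolynomial

universe u v w uK uA uB uC u₁ u₂

namespace DGSep

/-! ### Graded algebras -/

section Graded

variable {K : Type u} [CommRing K] {A : Type v} [Ring A] [Algebra K A]

/-- A `ℤ`-graded algebra is graded commutative if `a b = (-1)^{|a||b|} b a` for homogeneous
`a`, `b`. -/
def IsGradedCommutative (𝒜 : ℤ → Submodule K A) : Prop :=
  ∀ ⦃i j : ℤ⦄ ⦃a b : A⦄, a ∈ 𝒜 i → b ∈ 𝒜 j → a * b = (i * j).negOnePow • (b * a)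

/-- A graded-division ring: a nonzero graded ring in which every nonzero homogeneous element is
invertible. -/
def IsGradedDivision (𝒜 : ℤ → Submodule K A) [GradedAlgebra 𝒜] : Prop :=
  Nontrivial A ∧ ∀ ⦃i : ℤ⦄ ⦃a : A⦄, a ∈ 𝒜 i → a ≠ 0 → IsUnit a

/-- The sign map `a ↦ (-1)^{|a|} a` of a graded algebra, extended additively. -/
noncomputable def signMap (𝒜 : ℤ → Submodule K A) [GradedAlgebra 𝒜] : A →ₗ[K] A :=
  DirectSum.toModule K ℤ A (fun i => ((i.negOnePow : ℤˣ) : ℤ) • (𝒜 i).subtype) ∘ₗ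
    (DirectSum.decomposeLinearEquiv 𝒜).toLinearMap

theorem signMap_of_mem (𝒜 : ℤ → Submodule K A) [GradedAlgebra 𝒜] {i : ℤ} {a : A}
    (ha : a ∈ 𝒜 i) : signMap 𝒜 a = i.negOnePow • a := by
  simp only [signMap, LinearMap.comp_apply, LinearEquiv.coe_coe,
    DirectSum.decomposeLinearEquiv_apply, DirectSum.decompose_of_mem 𝒜 ha]
  rw [← DirectSum.lof_eq_of K, DirectSum.toModule_lof]
  rfl

/-- Two additive maps that agree on homogeneous elements are equal. -/
theorem ext_homogeneous (𝒜 : ℤ → Submodule K A) [GradedAlgebra 𝒜] {M : Type*} [AddCommGroup M]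
    {f g : A →+ M} (h : ∀ i, ∀ a ∈ 𝒜 i, f a = g a) (x : A) : f x = g x := by
  classical
  rw [← DirectSum.sum_support_decompose 𝒜 x, map_sum, map_sum]
  exact Finset.sum_congr rfl fun i _ => h i _ (SetLike.coe_mem _)

theorem signMap_mul (𝒜 : ℤ → Submodule K A) [GradedAlgebra 𝒜] (x y : A) :
    signMap 𝒜 (x * y) = signMap 𝒜 x * signMap 𝒜 y := by
  have key : ∀ i, ∀ a ∈ 𝒜 i, ∀ y, signMap 𝒜 (a * y) = signMap 𝒜 a * signMap 𝒜 y := by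
    intro i a ha y
    refine ext_homogeneous 𝒜
      (f := (signMap 𝒜).toAddMonoidHom.comp (AddMonoidHom.mulLeft a))
      (g := (AddMonoidHom.mulLeft (signMap 𝒜 a)).comp (signMap 𝒜).toAddMonoidHom) ?_ y
    intro j b hb
    change signMap 𝒜 (a * b) = signMap 𝒜 a * signMap 𝒜 b
    rw [signMap_of_mem 𝒜 ha, signMap_of_mem 𝒜 hb, signMap_of_mem 𝒜 (SetLike.mul_mem_graded ha hb),
      Int.negOnePow_add, mul_smul, smul_mul_assoc, mul_smul_comm]
  exact ext_homogeneous 𝒜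
      (f := (signMap 𝒜).toAddMonoidHom.comp (AddMonoidHom.mulRight y))
      (g := (AddMonoidHom.mulRight (signMap 𝒜 y)).comp (signMap 𝒜).toAddMonoidHom)
      (fun i a ha => key i a ha y) x

end Graded

/-! ### Tensor products over a ring extension and separable extensions

`R` and `S` are algebras over a commutative ring `k`, not assumed commutative. -/

section Tensor

variable {k : Type w} {R : Type u} {S : Type v} [CommRing k] [Ring R] [Ring S] [Algebra k R]
  [Algebra k S] (φ : R →ₐ[k] S)

/-- The relations `x φ(r) ⊗ y = x ⊗ φ(r) y` in `S ⊗_k S`. -/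
def balancedRel : Submodule k (S ⊗[k] S) :=
  Submodule.span k {z | ∃ (x : S) (r : R) (y : S), z = (x * φ r) ⊗ₜ[k] y - x ⊗ₜ[k] (φ r * y)}

/-- The tensor product `S ⊗_R S`, where `S` is an `R`-`R`-bimodule through `φ : R → S`. -/
abbrev BalTensor : Type v := (S ⊗[k] S) ⧸ balancedRel φ

/-- The element `x ⊗ y` of `S ⊗_R S`. -/
def tmul (x y : S) : BalTensor φ := (balancedRel φ).mkQ (x ⊗ₜ[k] y)

theorem tmul_balanced (x : S) (r : R) (y : S) : tmul φ (x * φ r) y = tmul φ x (φ r * y) :=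
  (Submodule.Quotient.eq _).2 (Submodule.subset_span ⟨x, r, y, rfl⟩)

/-- The left action `s (x ⊗ y) = s x ⊗ y` on `S ⊗_R S`. -/
def lmul (s : S) : BalTensor φ →ₗ[k] BalTensor φ :=
  (balancedRel φ).mapQ (balancedRel φ) (TensorProduct.map (LinearMap.mulLeft k s) LinearMap.id) (by
    refine Submodule.span_le.2 ?_
    rintro _ ⟨x, r, y, rfl⟩
    refine Submodule.subset_span ⟨s * x, r, y, ?_⟩
    simp [mul_assoc])

/-- The right action `(x ⊗ y) s = x ⊗ y s` on `S ⊗_R S`. -/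
def rmul (s : S) : BalTensor φ →ₗ[k] BalTensor φ :=
  (balancedRel φ).mapQ (balancedRel φ) (TensorProduct.map LinearMap.id (LinearMap.mulRight k s)) (by
    refine Submodule.span_le.2 ?_
    rintro _ ⟨x, r, y, rfl⟩
    refine Submodule.subset_span ⟨x, r, y * s, ?_⟩
    simp [mul_assoc])

/-- The multiplication map `S ⊗_R S → S`. -/
def mulMap : BalTensor φ →ₗ[k] S :=
  (balancedRel φ).liftQ (LinearMap.mul' k S) (by
    refine Submodule.span_le.2 ?_
    rintro _ ⟨x, r, y, rfl⟩
    simp [mul_assoc])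

theorem lmul_tmul (s x y : S) : lmul φ s (tmul φ x y) = tmul φ (s * x) y := rfl

theorem rmul_tmul (s x y : S) : rmul φ s (tmul φ x y) = tmul φ x (y * s) := rfl

theorem mulMap_tmul (x y : S) : mulMap φ (tmul φ x y) = x * y := rfl

/-- `ρ : S → S ⊗_R S` is a map of `S`-`S`-bimodules that splits the multiplication map. -/
structure IsBimoduleSection (ρ : S →ₗ[k] BalTensor φ) : Prop where
  map_mul_left : ∀ s x, ρ (s * x) = lmul φ s (ρ x)
  map_mul_right : ∀ x s, ρ (x * s) = rmul φ s (ρ x)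
  mulMap_apply : ∀ x, mulMap φ (ρ x) = x

/-- An extension `φ : R → S` of algebras is separable if the multiplication map `S ⊗_R S → S` is
split as a map of `S`-`S`-bimodules. -/
def IsSeparableExt : Prop := ∃ ρ : S →ₗ[k] BalTensor φ, IsBimoduleSection φ ρ

variable {σ : Type*} [SetLike σ S]

/-- The degree `n` part of `S ⊗_R S`: the elements `x ⊗ y` with `|x| + |y| = n` span it. -/
def tensorGrading (𝒮 : ℤ → σ) (n : ℤ) : Submodule k (BalTensor φ) :=
  Submodule.span k {z | ∃ (i j : ℤ) (x y : S), i + j = n ∧ x ∈ 𝒮 i ∧ y ∈ 𝒮 j ∧ z = tmul φ x y}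

/-- An extension `φ : R → S` of graded algebras is graded-separable if the multiplication map
`S ⊗_R S → S` is split as a map of graded `S`-`S`-bimodules. (The grading of `S ⊗_R S` is given by
that of `S`, hence that of `R` is not mentioned.) -/
def IsGradedSeparableExt (𝒮 : ℤ → σ) : Prop :=
  ∃ ρ : S →ₗ[k] BalTensor φ, IsBimoduleSection φ ρ ∧
    ∀ n, ∀ x ∈ 𝒮 n, ρ x ∈ tensorGrading φ 𝒮 n

end Tensor

/-! ### Differential graded algebras -/

section DG

variable (K : Type u) [CommRing K]

/-- The structure of a differential graded `K`-algebra on a `K`-algebra `A`. -/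
structure DGStructure (A : Type v) [Ring A] [Algebra K A] where
  /-- the homogeneous components -/
  gr : ℤ → Submodule K A
  [graded : GradedAlgebra gr]
  /-- the differential -/
  d : A →ₗ[K] A
  d_mem : ∀ ⦃i : ℤ⦄ ⦃a : A⦄, a ∈ gr i → d a ∈ gr (i + 1)
  d_d : ∀ a, d (d a) = 0
  leibniz : ∀ ⦃i : ℤ⦄ ⦃a : A⦄, a ∈ gr i → ∀ ⦃j : ℤ⦄ ⦃b : A⦄, b ∈ gr j →
    d (a * b) = d a * b + i.negOnePow • (a * d b)

attribute [instance] DGStructure.graded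

namespace DGStructure

variable {K} {A : Type v} [Ring A] [Algebra K A] (𝒜 : DGStructure K A)

theorem d_mul (x y : A) : 𝒜.d (x * y) = 𝒜.d x * y + signMap 𝒜.gr x * 𝒜.d y := by
  have key : ∀ i, ∀ a ∈ 𝒜.gr i, ∀ y, 𝒜.d (a * y) = 𝒜.d a * y + signMap 𝒜.gr a * 𝒜.d y := by
    intro i a ha y
    refine ext_homogeneous 𝒜.gr
      (f := 𝒜.d.toAddMonoidHom.comp (AddMonoidHom.mulLeft a))
      (g := AddMonoidHom.mulLeft (𝒜.d a) +
        (AddMonoidHom.mulLeft (signMap 𝒜.gr a)).comp 𝒜.d.toAddMonoidHom) ?_ y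
    intro j b hb
    simp [signMap_of_mem 𝒜.gr ha, 𝒜.leibniz ha hb, smul_mul_assoc]
  exact ext_homogeneous 𝒜.gr
      (f := 𝒜.d.toAddMonoidHom.comp (AddMonoidHom.mulRight y))
      (g := (AddMonoidHom.mulRight y).comp 𝒜.d.toAddMonoidHom +
        (AddMonoidHom.mulRight (𝒜.d y)).comp (signMap 𝒜.gr).toAddMonoidHom)
      (fun i a ha => key i a ha y) x

theorem d_one : 𝒜.d 1 = 0 := by
  have h := 𝒜.leibniz (SetLike.GradedOne.one_mem (A := 𝒜.gr))
    (SetLike.GradedOne.one_mem (A := 𝒜.gr))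
  simpa using h

/-- The algebra `ker d` of cycles. -/
def cycles : Subalgebra K A where
  carrier := {x | 𝒜.d x = 0}
  mul_mem' := by
    intro x y hx hy
    simp only [Set.mem_ofPred_eq] at hx hy ⊢
    simp [𝒜.d_mul, hx, hy]
  add_mem' := by
    intro x y hx hy
    simp only [Set.mem_ofPred_eq] at hx hy ⊢
    simp [hx, hy]
  algebraMap_mem' := by
    intro r
    simp [Algebra.algebraMap_eq_smul_one, 𝒜.d_one]

theorem mem_cycles {x : A} : x ∈ 𝒜.cycles ↔ 𝒜.d x = 0 := Iff.rfl

/-- The homogeneous components of the algebra of cycles: its elements of given degree in `A`. -/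
def cyclesGr (i : ℤ) : Submodule K 𝒜.cycles := (𝒜.gr i).comap 𝒜.cycles.val.toLinearMap

theorem mem_cyclesGr {i : ℤ} {x : 𝒜.cycles} : x ∈ 𝒜.cyclesGr i ↔ (x : A) ∈ 𝒜.gr i := Iff.rfl

theorem d_decompose (x : A) (i : ℤ) :
    𝒜.d (DirectSum.decompose 𝒜.gr x i) = DirectSum.decompose 𝒜.gr (𝒜.d x) (i + 1) := by
  refine ext_homogeneous 𝒜.gr
    (f := 𝒜.d.toAddMonoidHom.comp (GradedRing.proj 𝒜.gr i))
    (g := (GradedRing.proj 𝒜.gr (i + 1)).comp 𝒜.d.toAddMonoidHom) ?_ x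
  intro j a ha
  by_cases h : j = i
  · subst h
    simp [GradedRing.proj_apply, DirectSum.decompose_of_mem_same _ ha,
      DirectSum.decompose_of_mem_same _ (𝒜.d_mem ha)]
  · have h' : j + 1 ≠ i + 1 := fun e => h (by omega)
    simp [GradedRing.proj_apply, DirectSum.decompose_of_mem_ne _ ha h,
      DirectSum.decompose_of_mem_ne _ (𝒜.d_mem ha) h']

theorem decompose_mem_cycles {x : A} (hx : x ∈ 𝒜.cycles) (i : ℤ) :
    (DirectSum.decompose 𝒜.gr x i : A) ∈ 𝒜.cycles := by
  rw [mem_cycles, d_decompose, 𝒜.mem_cycles.1 hx]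
  simp

instance : SetLike.GradedMonoid 𝒜.cyclesGr where
  one_mem := SetLike.GradedOne.one_mem (A := 𝒜.gr)
  mul_mem _ _ _ _ ha hb := SetLike.mul_mem_graded (A := 𝒜.gr) ha hb

noncomputable instance : DirectSum.Decomposition 𝒜.cyclesGr :=
  DirectSum.IsInternal.chooseDecomposition (ℳ := 𝒜.cyclesGr) (by
    classical
    constructor
    · intro a b hab
      refine DFinsupp.ext fun i => Subtype.ext (Subtype.ext ?_)
      have key : ∀ c : DirectSum ℤ (fun i => 𝒜.cyclesGr i), ∀ i,
          (DirectSum.decompose 𝒜.gr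
            ((DirectSum.coeAddMonoidHom 𝒜.cyclesGr c : 𝒜.cycles) : A) i : A)
            = ((c i : 𝒜.cycles) : A) := by
        intro c i
        induction c using DirectSum.induction_on with
        | zero => simp
        | of j x =>
          rw [DirectSum.coeAddMonoidHom_of]
          by_cases h : j = i
          · subst h
            rw [DirectSum.decompose_of_mem_same 𝒜.gr (𝒜.mem_cyclesGr.1 x.2), DirectSum.of_eq_same]
          · rw [DirectSum.decompose_of_mem_ne 𝒜.gr (𝒜.mem_cyclesGr.1 x.2) h,
              DirectSum.of_eq_of_ne _ _ _ (Ne.symm h)]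
            rfl
        | add x y hx hy => simp [hx, hy]
      rw [← key a i, ← key b i, hab]
    · intro x
      refine ⟨∑ i ∈ (DirectSum.decompose 𝒜.gr (x : A)).support,
        DirectSum.of (fun i => 𝒜.cyclesGr i) i
          ⟨⟨DirectSum.decompose 𝒜.gr (x : A) i, 𝒜.decompose_mem_cycles x.2 i⟩,
            SetLike.coe_mem (DirectSum.decompose 𝒜.gr (x : A) i)⟩, ?_⟩
      rw [map_sum]
      simp only [DirectSum.coeAddMonoidHom_of]
      apply Subtype.ext
      rw [AddSubmonoidClass.coe_finsetSum]
      exact DirectSum.sum_support_decompose 𝒜.gr (x : A))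

/-- The algebra of cycles is a graded algebra. -/
noncomputable instance : GradedAlgebra 𝒜.cyclesGr where

/-- `H(A, d) = 0`: every cycle is a boundary. -/
def IsAcyclic : Prop := ∀ x, 𝒜.d x = 0 → ∃ y, 𝒜.d y = x

/-- A nonzero dg-algebra is a dg-division algebra if its only dg-left ideals and its only dg-right
ideals are `0` and `A`; here a dg-left (right) ideal is a left (right) ideal that is homogeneous and
stable under the differential. -/
structure IsDGDivision : Prop where
  nontrivial : Nontrivial A
  left_ideal : ∀ I : Submodule A A,
    (∀ x ∈ I, ∀ i, (DirectSum.decompose 𝒜.gr x i : A) ∈ I) → (∀ x ∈ I, 𝒜.d x ∈ I) →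
      I = ⊥ ∨ I = ⊤
  right_ideal : ∀ I : Submodule Aᵐᵒᵖ A,
    (∀ x ∈ I, ∀ i, (DirectSum.decompose 𝒜.gr x i : A) ∈ I) → (∀ x ∈ I, 𝒜.d x ∈ I) →
      I = ⊥ ∨ I = ⊤

end DGStructure

variable {K} {A : Type v} [Ring A] [Algebra K A] {B : Type w} [Ring B] [Algebra K B]

/-- A dg-extension `B → A`: a homomorphism of dg-`K`-algebras, that is, a `K`-algebra homomorphism
of degree `0` that commutes with the differentials. -/
structure DGExtension (ℬ : DGStructure K B) (𝒜 : DGStructure K A) extends B →ₐ[K] A where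
  map_gr : ∀ ⦃i : ℤ⦄ ⦃b : B⦄, b ∈ ℬ.gr i → toAlgHom b ∈ 𝒜.gr i
  map_d : ∀ b, toAlgHom (ℬ.d b) = 𝒜.d (toAlgHom b)

namespace DGExtension

variable {ℬ : DGStructure K B} {𝒜 : DGStructure K A} (φ : DGExtension ℬ 𝒜)

/-- The induced graded extension `ker d_B → ker d_A`. -/
def cyclesMap : ℬ.cycles →ₐ[K] 𝒜.cycles :=
  (φ.toAlgHom.comp ℬ.cycles.val).codRestrict 𝒜.cycles (fun x => by
    have h : ℬ.d (x : B) = 0 := x.2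
    simp [DGStructure.mem_cycles, ← φ.map_d, h])

theorem coe_cyclesMap (x : ℬ.cycles) : (φ.cyclesMap x : A) = φ.toAlgHom (x : B) := rfl

theorem map_signMap (b : B) :
    φ.toAlgHom (signMap ℬ.gr b) = signMap 𝒜.gr (φ.toAlgHom b) := by
  refine ext_homogeneous ℬ.gr
    (f := (φ.toAlgHom : B →+ A).comp (signMap ℬ.gr).toAddMonoidHom)
    (g := (signMap 𝒜.gr).toAddMonoidHom.comp (φ.toAlgHom : B →+ A)) ?_ b
  intro i b hb
  simp [signMap_of_mem _ hb, signMap_of_mem _ (φ.map_gr hb), Units.smul_def]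

/-- The differential `d_A ⊗ id + id ⊗ d_A` of `A ⊗_B A`, with the usual sign rule:
`x ⊗ y ↦ d x ⊗ y + (-1)^{|x|} x ⊗ d y` for homogeneous `x`. -/
noncomputable def tensorD : BalTensor φ.toAlgHom →ₗ[K] BalTensor φ.toAlgHom :=
  (balancedRel φ.toAlgHom).mapQ (balancedRel φ.toAlgHom)
    (TensorProduct.map 𝒜.d LinearMap.id + TensorProduct.map (signMap 𝒜.gr) 𝒜.d) (by
    refine Submodule.span_le.2 ?_
    rintro _ ⟨x, r, y, rfl⟩
    have h1 : (𝒜.d x * φ.toAlgHom r) ⊗ₜ[K] y - 𝒜.d x ⊗ₜ[K] (φ.toAlgHom r * y) ∈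
        balancedRel φ.toAlgHom := Submodule.subset_span ⟨_, _, _, rfl⟩
    have h2 : (signMap 𝒜.gr x * φ.toAlgHom (ℬ.d r)) ⊗ₜ[K] y -
        signMap 𝒜.gr x ⊗ₜ[K] (φ.toAlgHom (ℬ.d r) * y) ∈ balancedRel φ.toAlgHom :=
      Submodule.subset_span ⟨_, _, _, rfl⟩
    have h3 : (signMap 𝒜.gr x * φ.toAlgHom (signMap ℬ.gr r)) ⊗ₜ[K] 𝒜.d y -
        signMap 𝒜.gr x ⊗ₜ[K] (φ.toAlgHom (signMap ℬ.gr r) * 𝒜.d y) ∈ balancedRel φ.toAlgHom :=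
      Submodule.subset_span ⟨_, _, _, rfl⟩
    have e1 : φ.toAlgHom (ℬ.d r) = 𝒜.d (φ.toAlgHom r) := φ.map_d r
    have e2 : φ.toAlgHom (signMap ℬ.gr r) = signMap 𝒜.gr (φ.toAlgHom r) := φ.map_signMap r
    rw [e1] at h2
    rw [e2] at h3
    have := add_mem (add_mem h1 h2) h3
    simp only [SetLike.mem_coe, Submodule.mem_comap]
    convert this using 1
    simp only [LinearMap.add_apply, map_sub, TensorProduct.map_tmul, LinearMap.id_apply,
      𝒜.d_mul, signMap_mul, TensorProduct.add_tmul, TensorProduct.tmul_add]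
    abel)

theorem tensorD_tmul {i : ℤ} {x : A} (hx : x ∈ 𝒜.gr i) (y : A) :
    φ.tensorD (tmul φ.toAlgHom x y) =
      tmul φ.toAlgHom (𝒜.d x) y + i.negOnePow • tmul φ.toAlgHom x (𝒜.d y) := by
  have : φ.tensorD (tmul φ.toAlgHom x y) =
      tmul φ.toAlgHom (𝒜.d x) y + tmul φ.toAlgHom (signMap 𝒜.gr x) (𝒜.d y) := rfl
  rw [this, signMap_of_mem _ hx]
  simp only [tmul, Units.smul_def, ← TensorProduct.smul_tmul', map_zsmul]

/-- A dg-extension `B → A` is dg-separable if the multiplication map `A ⊗_B A → A` is split as a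
map of differential graded `A`-`A`-bimodules. -/
def IsDGSeparable : Prop :=
  ∃ ρ : A →ₗ[K] BalTensor φ.toAlgHom, IsBimoduleSection φ.toAlgHom ρ ∧
    (∀ k, ∀ x ∈ 𝒜.gr k, ρ x ∈ tensorGrading φ.toAlgHom 𝒜.gr k) ∧
    ∀ x, ρ (𝒜.d x) = φ.tensorD (ρ x)

end DGExtension

end DG

/-! ### Laurent polynomial rings -/

section Laurent

/-- The grading of `D[T, T⁻¹]` with `D` in degree `0` and `T` in degree `m`. -/
noncomputable def laurentGrading (D : Type u) [Field D] (m : ℤ) : ℤ → Submodule D D[T;T⁻¹] :=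
  AddMonoidAlgebra.gradeBy D (AddMonoidHom.mulLeft m)

/-- The subring `D₁[Tⁿ, T⁻ⁿ]` of `D₂[T, T⁻¹]`. -/
noncomputable def laurentSub (D₁ : Type u) (D₂ : Type v) [Field D₁] [Field D₂] [Algebra D₁ D₂]
    (n : ℤ) : Subalgebra D₁ D₂[T;T⁻¹] :=
  Algebra.adjoin D₁ {LaurentPolynomial.T n, LaurentPolynomial.T (-n)}

end Laurent

end DGSep

/-!
A bimodule section `ρ` of the multiplication `μ : S ⊗_R S → S` is determined by `e = ρ 1`, and the
elements that arise are the separability idempotents: those with `s e = e s` for all `s ∈ S` and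
`μ e = 1`. Gradedness of `ρ` means that `e` has degree `0`, and compatibility with the differentials
means that `d e = 0`. The statements on separability are proved by moving such elements along maps
between tensor products.

*Cycles.* For a nonzero homogeneous cycle `a`, the ideal `A a` is homogeneous and `d`-stable, hence
is `A`; the inverse of `a` is again a cycle by the Leibniz rule.

*Acyclic dg-algebras.* If `A` is acyclic, then `d y = 1` for some `y` of degree `-1`, and every `x`
is `(x - y d x) + y d x`, so that `A = ker d ⊕ y ker d`. If `B` is acyclic, take `y` in the image of
`B`. The image in `A ⊗_B A` of a separability idempotent of the cycles is a cycle and commutes with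
`ker d`; it commutes with `y` as well, because `y` can be carried across `⊗_B` and the signs cancel
in total degree `0` (`lmul_eq_rmul_of_mem_tensorGrading_zero`). In characteristic different from `2`
the odd element `y` has square zero, so that `π x = x - y d x` is a homomorphism of algebras
`A → ker d` (`cyclesProj`), and `π ⊗ π` carries separability idempotents back to the cycles. If
`d_B = 0` instead, then `x ⊗ z ↦ d x · π z` is well defined on `A ⊗_B A`; it sends `y e` to
`π (μ e) = 1` and `e y` to `0`, so that there is no separability idempotent.

*Graded-commutative gr-division rings.* Odd elements have square zero, hence vanish, and the degrees
of nonzero homogeneous elements form a subgroup `m ℤ`. If `m ≠ 0`, a unit of degree `m` serves as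
`T`, over the field of elements of degree `0`.

*Laurent polynomials.* If `e₀` is a separability idempotent of `D₁ ⊆ D₂` and `n` is invertible, then
`|n|⁻¹ ∑ T^j e₀ T^{-j}`, `0 ≤ j < |n|`, is one of `D₁[Tⁿ, T⁻ⁿ] ⊆ D₂[T, T⁻¹]`. Conversely, let
`residue` keep the part `a ⊗ b` of `a T^i ⊗ b T^{-i}` with `n ∣ i` and annihilate the other
monomials. The constant coefficient of `μ z` is `∑ μ (residue (T^{-i} z T^i))`, `0 ≤ i < |n|`
(`coeff_mulMap_eq_sum`). For a separability idempotent `e` this reads `1 = |n| · μ (residue e)`, so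
`n` is invertible and `|n| · residue e` is a separability idempotent of `D₁ ⊆ D₂`.
-/

namespace DGSep

/-! ### Bimodule sections and separability idempotents -/

section BalTensor

variable {k : Type*} {R S R' S' M : Type*} [CommRing k] [Ring R] [Ring S] [Algebra k R]
  [Algebra k S] [Ring R'] [Ring S'] [Algebra k R'] [Algebra k S'] [AddCommGroup M] [Module k M]
  (φ : R →ₐ[k] S) (ψ : R' →ₐ[k] S')

@[elab_as_elim]
theorem BalTensor.induction_on {p : BalTensor φ → Prop} (z : BalTensor φ) (zero : p 0)
    (tmul : ∀ x y, p (tmul φ x y)) (add : ∀ z w, p z → p w → p (z + w)) : p z := by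
  obtain ⟨t, rfl⟩ := (balancedRel φ).mkQ_surjective z
  induction t using TensorProduct.induction_on with
  | zero => simpa using zero
  | tmul x y => exact tmul x y
  | add s t hs ht => rw [map_add]; exact add _ _ hs ht

/-- The linear map out of `S ⊗_R S` given by an `R`-balanced `k`-bilinear map. -/
def BalTensor.lift (f : S →ₗ[k] S →ₗ[k] M) (h : ∀ x r y, f (x * φ r) y = f x (φ r * y)) :
    BalTensor φ →ₗ[k] M :=
  (balancedRel φ).liftQ (TensorProduct.lift f) (by
    refine Submodule.span_le.2 ?_
    rintro _ ⟨x, r, y, rfl⟩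
    simp [h])

/-- The map `S ⊗_R S → S' ⊗_{R'} S'`, `x ⊗ y ↦ f x ⊗ f y`, induced by an algebra homomorphism
`f : S → S'` that sends the image of `R` into the image of `R'`. -/
def BalTensor.map (f : S →ₐ[k] S') (h : ∀ r, ∃ r', f (φ r) = ψ r') :
    BalTensor φ →ₗ[k] BalTensor ψ :=
  BalTensor.lift φ
    (((TensorProduct.mk k S' S').compr₂ (balancedRel ψ).mkQ).compl₁₂ f.toLinearMap f.toLinearMap)
    (fun x r y => by
      obtain ⟨r', hr'⟩ := h r
      change tmul ψ (f (x * φ r)) (f y) = tmul ψ (f x) (f (φ r * y))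
      rw [map_mul, map_mul, hr', tmul_balanced])

variable {φ ψ}

theorem BalTensor.map_tmul {f : S →ₐ[k] S'} (h : ∀ r, ∃ r', f (φ r) = ψ r') (x y : S) :
    BalTensor.map φ ψ f h (tmul φ x y) = tmul ψ (f x) (f y) := rfl

theorem tmul_add_left (x x' y : S) : tmul φ (x + x') y = tmul φ x y + tmul φ x' y := by
  simp only [tmul, TensorProduct.add_tmul, map_add]

theorem tmul_add_right (x y y' : S) : tmul φ x (y + y') = tmul φ x y + tmul φ x y' := by
  simp only [tmul, TensorProduct.tmul_add, map_add]

theorem tmul_smul_left (c : k) (x y : S) : tmul φ (c • x) y = c • tmul φ x y := by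
  simp only [tmul, ← TensorProduct.smul_tmul', map_smul]

theorem lmul_add (s t : S) (z : BalTensor φ) : lmul φ (s + t) z = lmul φ s z + lmul φ t z := by
  induction z using BalTensor.induction_on with
  | zero => simp
  | tmul x y => simp only [lmul_tmul, add_mul, tmul_add_left]
  | add z w hz hw => simp only [map_add, hz, hw]; abel

theorem rmul_add (s t : S) (z : BalTensor φ) : rmul φ (s + t) z = rmul φ s z + rmul φ t z := by
  induction z using BalTensor.induction_on with
  | zero => simp
  | tmul x y => simp only [rmul_tmul, mul_add, tmul_add_right]
  | add z w hz hw => simp only [map_add, hz, hw]; abel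

theorem lmul_smul (c : k) (s : S) (z : BalTensor φ) : lmul φ (c • s) z = c • lmul φ s z := by
  induction z using BalTensor.induction_on with
  | zero => simp
  | tmul x y => simp only [lmul_tmul, smul_mul_assoc, tmul_smul_left]
  | add z w hz hw => simp only [map_add, hz, hw, smul_add]

theorem lmul_mul (s t : S) (z : BalTensor φ) : lmul φ (s * t) z = lmul φ s (lmul φ t z) := by
  induction z using BalTensor.induction_on with
  | zero => simp
  | tmul x y => simp only [lmul_tmul, mul_assoc]
  | add z w hz hw => simp only [map_add, hz, hw]

theorem rmul_mul (s t : S) (z : BalTensor φ) : rmul φ (s * t) z = rmul φ t (rmul φ s z) := by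
  induction z using BalTensor.induction_on with
  | zero => simp
  | tmul x y => simp only [rmul_tmul, mul_assoc]
  | add z w hz hw => simp only [map_add, hz, hw]

theorem lmul_rmul (s t : S) (z : BalTensor φ) :
    lmul φ s (rmul φ t z) = rmul φ t (lmul φ s z) := by
  induction z using BalTensor.induction_on with
  | zero => simp
  | tmul x y => rfl
  | add z w hz hw => simp only [map_add, hz, hw]

theorem lmul_one (z : BalTensor φ) : lmul φ 1 z = z := by
  induction z using BalTensor.induction_on with
  | zero => simp
  | tmul x y => simp only [lmul_tmul, one_mul]
  | add z w hz hw => simp only [map_add, hz, hw]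

theorem rmul_one (z : BalTensor φ) : rmul φ 1 z = z := by
  induction z using BalTensor.induction_on with
  | zero => simp
  | tmul x y => simp only [rmul_tmul, mul_one]
  | add z w hz hw => simp only [map_add, hz, hw]

theorem mulMap_lmul (s : S) (z : BalTensor φ) : mulMap φ (lmul φ s z) = s * mulMap φ z := by
  induction z using BalTensor.induction_on with
  | zero => simp
  | tmul x y => simp only [lmul_tmul, mulMap_tmul, mul_assoc]
  | add z w hz hw => simp only [map_add, hz, hw, mul_add]

theorem BalTensor.map_lmul {f : S →ₐ[k] S'} (h : ∀ r, ∃ r', f (φ r) = ψ r') (s : S)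
    (z : BalTensor φ) :
    BalTensor.map φ ψ f h (lmul φ s z) = lmul ψ (f s) (BalTensor.map φ ψ f h z) := by
  induction z using BalTensor.induction_on with
  | zero => simp
  | tmul x y => simp only [lmul_tmul, BalTensor.map_tmul, map_mul]
  | add z w hz hw => simp only [map_add, hz, hw]

theorem BalTensor.map_rmul {f : S →ₐ[k] S'} (h : ∀ r, ∃ r', f (φ r) = ψ r') (s : S)
    (z : BalTensor φ) :
    BalTensor.map φ ψ f h (rmul φ s z) = rmul ψ (f s) (BalTensor.map φ ψ f h z) := by
  induction z using BalTensor.induction_on with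
  | zero => simp
  | tmul x y => simp only [rmul_tmul, BalTensor.map_tmul, map_mul]
  | add z w hz hw => simp only [map_add, hz, hw]

theorem BalTensor.mulMap_map {f : S →ₐ[k] S'} (h : ∀ r, ∃ r', f (φ r) = ψ r')
    (z : BalTensor φ) : mulMap ψ (BalTensor.map φ ψ f h z) = f (mulMap φ z) := by
  induction z using BalTensor.induction_on with
  | zero => simp
  | tmul x y => simp only [mulMap_tmul, BalTensor.map_tmul, map_mul]
  | add z w hz hw => simp only [map_add, hz, hw]

theorem BalTensor.map_mem_tensorGrading {σ σ' : Type*} [SetLike σ S] [SetLike σ' S']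
    {𝒮 : ℤ → σ} {𝒮' : ℤ → σ'} {f : S →ₐ[k] S'} (h : ∀ r, ∃ r', f (φ r) = ψ r')
    (hf : ∀ i, ∀ x ∈ 𝒮 i, f x ∈ 𝒮' i) {n : ℤ} {z : BalTensor φ} (hz : z ∈ tensorGrading φ 𝒮 n) :
    BalTensor.map φ ψ f h z ∈ tensorGrading ψ 𝒮' n := by
  induction hz using Submodule.span_induction with
  | mem z hz =>
    obtain ⟨i, j, x, y, hij, hx, hy, rfl⟩ := hz
    exact Submodule.subset_span ⟨i, j, f x, f y, hij, hf i x hx, hf j y hy, rfl⟩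
  | zero => rw [map_zero]; exact zero_mem _
  | add z w _ _ hz hw => rw [map_add]; exact add_mem hz hw
  | smul c z _ hz => rw [map_smul]; exact Submodule.smul_mem _ c hz

variable (φ) in
/-- An element `e` of `S ⊗_R S` is a separability idempotent if `s e = e s` for all `s ∈ S` and the
multiplication map sends `e` to `1`. -/
structure IsSeparabilityIdempotent (e : BalTensor φ) : Prop where
  lmul_eq_rmul : ∀ s, lmul φ s e = rmul φ s e
  mulMap_eq_one : mulMap φ e = 1

/-- The map of left `S`-modules `S → S ⊗_R S` that sends `1` to `e`. -/
def sectionOf (e : BalTensor φ) : S →ₗ[k] BalTensor φ where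
  toFun s := lmul φ s e
  map_add' s t := lmul_add s t e
  map_smul' c s := lmul_smul c s e

theorem sectionOf_apply (e : BalTensor φ) (s : S) : sectionOf e s = lmul φ s e := rfl

theorem IsSeparabilityIdempotent.isBimoduleSection {e : BalTensor φ}
    (he : IsSeparabilityIdempotent φ e) : IsBimoduleSection φ (sectionOf e) where
  map_mul_left s x := lmul_mul s x e
  map_mul_right x s := by
    rw [sectionOf_apply, sectionOf_apply, lmul_mul, he.lmul_eq_rmul, lmul_rmul]
  mulMap_apply x := by rw [sectionOf_apply, mulMap_lmul, he.mulMap_eq_one, mul_one]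

theorem IsBimoduleSection.isSeparabilityIdempotent {ρ : S →ₗ[k] BalTensor φ}
    (hρ : IsBimoduleSection φ ρ) : IsSeparabilityIdempotent φ (ρ 1) where
  lmul_eq_rmul s := by rw [← hρ.map_mul_left, ← hρ.map_mul_right, mul_one, one_mul]
  mulMap_eq_one := hρ.mulMap_apply 1

theorem isSeparableExt_iff : IsSeparableExt φ ↔ ∃ e, IsSeparabilityIdempotent φ e :=
  ⟨fun ⟨_, hρ⟩ => ⟨_, hρ.isSeparabilityIdempotent⟩, fun ⟨_, he⟩ => ⟨_, he.isBimoduleSection⟩⟩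

theorem lmul_mem_tensorGrading {σ : Type*} [SetLike σ S] {𝒮 : ℤ → σ} [SetLike.GradedMonoid 𝒮]
    {i j : ℤ} {s : S} (hs : s ∈ 𝒮 i) {z : BalTensor φ} (hz : z ∈ tensorGrading φ 𝒮 j) :
    lmul φ s z ∈ tensorGrading φ 𝒮 (i + j) := by
  induction hz using Submodule.span_induction with
  | mem z hz =>
    obtain ⟨a, b, x, y, hab, hx, hy, rfl⟩ := hz
    exact Submodule.subset_span
      ⟨i + a, b, s * x, y, by rw [← hab, add_assoc], SetLike.mul_mem_graded hs hx, hy, rfl⟩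
  | zero => rw [map_zero]; exact zero_mem _
  | add z w _ _ hz hw => rw [map_add]; exact add_mem hz hw
  | smul c z _ hz => rw [map_smul]; exact Submodule.smul_mem _ c hz

theorem sectionOf_mem_tensorGrading {σ : Type*} [SetLike σ S] {𝒮 : ℤ → σ}
    [SetLike.GradedMonoid 𝒮] {e : BalTensor φ} (he : e ∈ tensorGrading φ 𝒮 0) {n : ℤ} {x : S}
    (hx : x ∈ 𝒮 n) : sectionOf e x ∈ tensorGrading φ 𝒮 n := by
  have := lmul_mem_tensorGrading hx he
  rwa [add_zero] at this

theorem isGradedSeparableExt_iff {σ : Type*} [SetLike σ S] {𝒮 : ℤ → σ} [SetLike.GradedMonoid 𝒮] :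
    IsGradedSeparableExt φ 𝒮 ↔
      ∃ e, IsSeparabilityIdempotent φ e ∧ e ∈ tensorGrading φ 𝒮 0 :=
  ⟨fun ⟨_, hρ, hgr⟩ => ⟨_, hρ.isSeparabilityIdempotent, hgr 0 1 SetLike.GradedOne.one_mem⟩,
    fun ⟨e, he, he0⟩ => ⟨sectionOf e, he.isBimoduleSection,
      fun _ _ hx => sectionOf_mem_tensorGrading he0 hx⟩⟩

end BalTensor

/-! ### Graded commutativity and signs -/

section GradedCommutative

/-- The component of degree `-i` of a left inverse of `a ∈ A_i` is a left inverse too. -/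
theorem decompose_neg_mul_eq_one {K A : Type*} [CommRing K] [Ring A] [Algebra K A]
    (𝒜 : ℤ → Submodule K A) [GradedAlgebra 𝒜] {i : ℤ} {a x : A} (ha : a ∈ 𝒜 i) (hx : x * a = 1) :
    (DirectSum.decompose 𝒜 x (-i) : A) * a = 1 := by
  have := DirectSum.coe_decompose_mul_add_of_right_mem 𝒜 (i := -i) (a := x) ha
  rw [hx, neg_add_cancel,
    DirectSum.decompose_of_mem_same _ (SetLike.GradedOne.one_mem (A := 𝒜))] at this
  exact this.symm

variable {K : Type*} {A : Type*} [Ring A]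

theorem signMap_signMap [CommRing K] [Algebra K A] (𝒜 : ℤ → Submodule K A) [GradedAlgebra 𝒜]
    (x : A) : signMap 𝒜 (signMap 𝒜 x) = x := by
  refine ext_homogeneous 𝒜
    (f := (signMap 𝒜).toAddMonoidHom.comp (signMap 𝒜).toAddMonoidHom)
    (g := AddMonoidHom.id A) (fun i a ha => ?_) x
  change signMap 𝒜 (signMap 𝒜 a) = a
  rw [signMap_of_mem 𝒜 ha, Units.smul_def, map_zsmul, signMap_of_mem 𝒜 ha, ← Units.smul_def,
    smul_smul, Int.units_mul_self, one_smul]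

theorem IsGradedCommutative.mul_eq_signMap_mul [CommRing K] [Algebra K A]
    {𝒜 : ℤ → Submodule K A} [GradedAlgebra 𝒜] (h : IsGradedCommutative 𝒜) {y : A}
    (hy : y ∈ 𝒜 (-1)) (x : A) : y * x = signMap 𝒜 x * y := by
  refine ext_homogeneous 𝒜 (f := AddMonoidHom.mulLeft y)
    (g := (AddMonoidHom.mulRight y).comp (signMap 𝒜).toAddMonoidHom) (fun i a ha => ?_) x
  change y * a = signMap 𝒜 a * y
  rw [h hy ha, signMap_of_mem 𝒜 ha, smul_mul_assoc, neg_one_mul, Int.negOnePow_neg]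

theorem IsGradedCommutative.mul_eq_mul_signMap [CommRing K] [Algebra K A]
    {𝒜 : ℤ → Submodule K A} [GradedAlgebra 𝒜] (h : IsGradedCommutative 𝒜) {y : A}
    (hy : y ∈ 𝒜 (-1)) (x : A) : x * y = y * signMap 𝒜 x := by
  rw [h.mul_eq_signMap_mul hy, signMap_signMap]

theorem IsGradedCommutative.mul_self_eq_zero_of_odd [Field K] [Algebra K A]
    {𝒜 : ℤ → Submodule K A} (h : IsGradedCommutative 𝒜) (h2 : ringChar K ≠ 2) {i : ℤ}
    (hi : Odd i) {a : A} (ha : a ∈ 𝒜 i) : a * a = 0 := by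
  have h1 : a * a = -(a * a) := by
    conv_lhs => rw [h ha ha, Int.negOnePow_odd _ (hi.mul hi), Units.neg_smul, one_smul]
  have h3 : (2 : K) • (a * a) = 0 := by
    rw [two_smul]
    exact eq_neg_iff_add_eq_zero.1 h1
  exact (smul_eq_zero.1 h3).resolve_left (Ring.two_ne_zero h2)

end GradedCommutative

/-! ### Cycles of a graded commutative dg-division algebra -/

namespace DGStructure

variable {K : Type*} {A : Type*} [Ring A]

section

variable [CommRing K] [Algebra K A] {𝒜 : DGStructure K A}

theorem isGradedCommutative_cyclesGr (h : IsGradedCommutative 𝒜.gr) :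
    IsGradedCommutative 𝒜.cyclesGr := by
  intro i j a b ha hb
  apply Subtype.ext
  have := h (𝒜.mem_cyclesGr.1 ha) (𝒜.mem_cyclesGr.1 hb)
  simpa [Units.smul_def] using this

/-- For a homogeneous cycle `a`, the left ideal `A a` is homogeneous and stable under `d`. -/
theorem IsDGDivision.exists_mul_eq_one (h : 𝒜.IsDGDivision) {i : ℤ} {a : A} (ha : a ∈ 𝒜.gr i)
    (hd : 𝒜.d a = 0) (h0 : a ≠ 0) : ∃ x, x * a = 1 := by
  have key := h.left_ideal (Submodule.span A {a}) ?_ ?_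
  · have htop : Submodule.span A {a} = ⊤ :=
      key.resolve_left (fun hb => h0 (Submodule.span_singleton_eq_bot.1 hb))
    exact Submodule.mem_span_singleton.1 (htop ▸ Submodule.mem_top (x := (1 : A)))
  · intro x hx n
    obtain ⟨c, rfl⟩ := Submodule.mem_span_singleton.1 hx
    refine Submodule.mem_span_singleton.2 ⟨DirectSum.decompose 𝒜.gr c (n - i), ?_⟩
    have := DirectSum.coe_decompose_mul_add_of_right_mem 𝒜.gr (i := n - i) (a := c) ha
    rw [sub_add_cancel] at this
    exact this.symm
  · intro x hx
    obtain ⟨c, rfl⟩ := Submodule.mem_span_singleton.1 hx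
    refine Submodule.mem_span_singleton.2 ⟨𝒜.d c, ?_⟩
    simp [𝒜.d_mul, hd]

theorem IsDGDivision.isGradedDivision_cyclesGr (h : 𝒜.IsDGDivision)
    (hc : IsGradedCommutative 𝒜.gr) : IsGradedDivision 𝒜.cyclesGr := by
  have := h.nontrivial
  refine ⟨inferInstance, fun i a ha h0 => ?_⟩
  have ha' : (a : A) ∈ 𝒜.gr i := ha
  have hd : 𝒜.d (a : A) = 0 := a.2
  obtain ⟨x, hx⟩ := h.exists_mul_eq_one ha' hd (fun e => h0 (Subtype.ext e))
  obtain ⟨x', hxm, hx1⟩ : ∃ x' ∈ 𝒜.gr (-i), x' * (a : A) = 1 :=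
    ⟨_, SetLike.coe_mem _, decompose_neg_mul_eq_one 𝒜.gr ha' hx⟩
  have hright : ∃ z, (a : A) * z = 1 :=
    ⟨(i * -i).negOnePow • x', by rw [mul_smul_comm, hc ha' hxm, smul_smul, Int.units_mul_self,
      one_smul, hx1]⟩
  obtain ⟨z, hz⟩ := hright
  have hzx : x' = z := left_inv_eq_right_inv hx1 hz
  subst hzx
  have hdx : 𝒜.d x' = 0 := by
    have h1 : 𝒜.d x' * a = 0 := by
      have := 𝒜.d_mul x' a
      rwa [hx1, 𝒜.d_one, hd, mul_zero, add_zero, eq_comm] at this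
    rw [← mul_one (𝒜.d x'), ← hz, ← mul_assoc, h1, zero_mul]
  exact ⟨⟨a, ⟨x', hdx⟩, Subtype.ext hz, Subtype.ext hx1⟩, rfl⟩

/-! ### Acyclic dg-algebras -/

theorem IsAcyclic.exists_d_eq_one (h : 𝒜.IsAcyclic) : ∃ y ∈ 𝒜.gr (-1), 𝒜.d y = 1 := by
  obtain ⟨y, hy⟩ := h 1 𝒜.d_one
  refine ⟨DirectSum.decompose 𝒜.gr y (-1), SetLike.coe_mem _, ?_⟩
  rw [𝒜.d_decompose, hy, neg_add_cancel,
    DirectSum.decompose_of_mem_same _ (SetLike.GradedOne.one_mem (A := 𝒜.gr))]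

theorem d_mul_of_mem_neg_one {y : A} (hy : y ∈ 𝒜.gr (-1)) (hdy : 𝒜.d y = 1) (x : A) :
    𝒜.d (y * x) = x - y * 𝒜.d x := by
  rw [𝒜.d_mul, hdy, one_mul, signMap_of_mem _ hy, Int.negOnePow_neg, Int.negOnePow_one,
    Units.neg_smul, one_smul, neg_mul, sub_eq_add_neg]

theorem d_sub_mul_d {y : A} (hy : y ∈ 𝒜.gr (-1)) (hdy : 𝒜.d y = 1) (x : A) :
    𝒜.d (x - y * 𝒜.d x) = 0 := by
  rw [map_sub, d_mul_of_mem_neg_one hy hdy, 𝒜.d_d, mul_zero, sub_zero, sub_self]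

theorem isAcyclic_of_d_eq_one {y : A} (hy : y ∈ 𝒜.gr (-1)) (hdy : 𝒜.d y = 1) : 𝒜.IsAcyclic :=
  fun x hx => ⟨y * x, by rw [d_mul_of_mem_neg_one hy hdy, hx, mul_zero, sub_zero]⟩

/-- If `d y = 1` with `|y| = -1` and `y² = 0`, then `A = ker d ⊕ y ker d`, the summand `y ker d` is
an ideal, and `x ↦ x - y d x` is the projection onto `ker d`, a homomorphism of algebras. -/
def cyclesProj (hc : IsGradedCommutative 𝒜.gr) {y : A} (hy : y ∈ 𝒜.gr (-1)) (hdy : 𝒜.d y = 1)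
    (hyy : y * y = 0) : A →ₐ[K] 𝒜.cycles :=
  AlgHom.ofLinearMap
    { toFun := fun x => ⟨x - y * 𝒜.d x, d_sub_mul_d hy hdy x⟩
      map_add' := fun x z => Subtype.ext (by
        simp only [map_add, mul_add]; exact add_sub_add_comm ..)
      map_smul' := fun c x => Subtype.ext (by
        simp only [map_smul, mul_smul_comm]; exact (smul_sub ..).symm) }
    (Subtype.ext (by simp [𝒜.d_one]))
    (fun x z => Subtype.ext (by
      have h1 : y * signMap 𝒜.gr x = x * y := (hc.mul_eq_mul_signMap hy x).symm
      have h2 : y * 𝒜.d x * (y * 𝒜.d z) = 0 := by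
        rw [mul_assoc, ← mul_assoc (𝒜.d x), hc.mul_eq_mul_signMap hy (𝒜.d x), ← mul_assoc,
          ← mul_assoc, hyy, zero_mul, zero_mul]
      change x * z - y * 𝒜.d (x * z) = (x - y * 𝒜.d x) * (z - y * 𝒜.d z)
      rw [𝒜.d_mul, mul_add, ← mul_assoc y (signMap 𝒜.gr x), h1, sub_mul, mul_sub, mul_sub, h2]
      simp only [mul_assoc]
      abel))

theorem coe_cyclesProj (hc : IsGradedCommutative 𝒜.gr) {y : A} (hy : y ∈ 𝒜.gr (-1))
    (hdy : 𝒜.d y = 1) (hyy : y * y = 0) (x : A) :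
    (cyclesProj hc hy hdy hyy x : A) = x - y * 𝒜.d x := rfl

theorem cyclesProj_of_mem_cycles (hc : IsGradedCommutative 𝒜.gr) {y : A} (hy : y ∈ 𝒜.gr (-1))
    (hdy : 𝒜.d y = 1) (hyy : y * y = 0) (x : 𝒜.cycles) :
    cyclesProj hc hy hdy hyy (x : A) = x :=
  Subtype.ext (by rw [coe_cyclesProj, 𝒜.mem_cycles.1 x.2, mul_zero, sub_zero])

theorem cyclesProj_mem_cyclesGr (hc : IsGradedCommutative 𝒜.gr) {y : A} (hy : y ∈ 𝒜.gr (-1))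
    (hdy : 𝒜.d y = 1) (hyy : y * y = 0) {i : ℤ} {x : A} (hx : x ∈ 𝒜.gr i) :
    cyclesProj hc hy hdy hyy x ∈ 𝒜.cyclesGr i := by
  rw [mem_cyclesGr, coe_cyclesProj]
  refine sub_mem hx ?_
  have := SetLike.mul_mem_graded hy (𝒜.d_mem hx)
  rwa [neg_add_cancel_comm_assoc] at this

end

end DGStructure

/-! ### dg-separable extensions -/

namespace DGExtension

variable {K : Type*} {A B : Type*} [Ring A] [Ring B]

section

variable [CommRing K] [Algebra K A] [Algebra K B]
  {ℬ : DGStructure K B} {𝒜 : DGStructure K A} (φ : DGExtension ℬ 𝒜)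

theorem tensorD_tmul_signMap (x y : A) : φ.tensorD (tmul φ.toAlgHom x y) =
    tmul φ.toAlgHom (𝒜.d x) y + tmul φ.toAlgHom (signMap 𝒜.gr x) (𝒜.d y) := rfl

theorem tensorD_lmul (x : A) (z : BalTensor φ.toAlgHom) :
    φ.tensorD (lmul φ.toAlgHom x z) =
      lmul φ.toAlgHom (𝒜.d x) z + lmul φ.toAlgHom (signMap 𝒜.gr x) (φ.tensorD z) := by
  induction z using BalTensor.induction_on with
  | zero => simp
  | tmul a b =>
    rw [lmul_tmul, tensorD_tmul_signMap, tensorD_tmul_signMap, 𝒜.d_mul, signMap_mul, map_add,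
      lmul_tmul, lmul_tmul, lmul_tmul, ← add_assoc]
    congr 1
    exact tmul_add_left _ _ _
  | add z w hz hw => simp only [map_add, hz, hw]; abel

theorem isDGSeparable_iff : φ.IsDGSeparable ↔ ∃ e, IsSeparabilityIdempotent φ.toAlgHom e ∧
    e ∈ tensorGrading φ.toAlgHom 𝒜.gr 0 ∧ φ.tensorD e = 0 := by
  constructor
  · rintro ⟨ρ, hρ, hgr, hd⟩
    exact ⟨ρ 1, hρ.isSeparabilityIdempotent, hgr 0 1 SetLike.GradedOne.one_mem, by
      rw [← hd, 𝒜.d_one, map_zero]⟩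
  · rintro ⟨e, he, he0, hd⟩
    refine ⟨sectionOf e, he.isBimoduleSection, fun _ _ hx => sectionOf_mem_tensorGrading he0 hx,
      fun x => ?_⟩
    rw [sectionOf_apply, sectionOf_apply, tensorD_lmul, hd, map_zero, add_zero]

/-- The map `ker d_A ⊗ ker d_A → A ⊗ A`, with tensor products over `ker d_B` and `B`. -/
def cyclesTensorMap : BalTensor φ.cyclesMap →ₗ[K] BalTensor φ.toAlgHom :=
  BalTensor.map φ.cyclesMap φ.toAlgHom 𝒜.cycles.val (fun r => ⟨(r : B), rfl⟩)

theorem tensorD_cyclesTensorMap (z : BalTensor φ.cyclesMap) :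
    φ.tensorD (φ.cyclesTensorMap z) = 0 := by
  induction z using BalTensor.induction_on with
  | zero => simp
  | tmul x y =>
    have hx : 𝒜.d (x : A) = 0 := x.2
    have hy : 𝒜.d (y : A) = 0 := y.2
    change φ.tensorD (tmul φ.toAlgHom (x : A) (y : A)) = 0
    rw [tensorD_tmul_signMap, hx, hy]
    simp [tmul]
  | add z w hz hw => rw [map_add, map_add, hz, hw, add_zero]

variable {φ} in
/-- Moving `φ b` past both factors of `x ⊗ y` costs the sign `(-1)^{|b| (|x| + |y|)}`, which is `1`
in total degree `0`. -/
theorem lmul_eq_rmul_of_mem_tensorGrading_zero (hc : IsGradedCommutative 𝒜.gr) {b : B} {n : ℤ}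
    (hb : b ∈ ℬ.gr n) {z : BalTensor φ.toAlgHom} (hz : z ∈ tensorGrading φ.toAlgHom 𝒜.gr 0) :
    lmul φ.toAlgHom (φ.toAlgHom b) z = rmul φ.toAlgHom (φ.toAlgHom b) z := by
  induction hz using Submodule.span_induction with
  | mem z hz =>
    obtain ⟨i, j, x, y, hij, hx, hy, rfl⟩ := hz
    have hb' := φ.map_gr hb
    have e1 : ∀ (s : ℤˣ) (p q : A), tmul φ.toAlgHom (s • p) q = s • tmul φ.toAlgHom p q := by
      intro s p q
      simp only [tmul, Units.smul_def, ← TensorProduct.smul_tmul', map_zsmul]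
    have e2 : ∀ (s : ℤˣ) (p q : A), tmul φ.toAlgHom p (s • q) = s • tmul φ.toAlgHom p q := by
      intro s p q
      simp only [tmul, Units.smul_def, TensorProduct.tmul_smul, map_zsmul]
    rw [lmul_tmul, rmul_tmul, hc hb' hx, e1, tmul_balanced, hc hb' hy, e2, smul_smul,
      ← Int.negOnePow_add, ← mul_add, hij, mul_zero, Int.negOnePow_zero, one_smul]
  | zero => simp
  | add z w _ _ hz hw => rw [map_add, map_add, hz, hw]
  | smul c z _ hz => rw [map_smul, map_smul, hz]

theorem isAcyclic (φ : DGExtension ℬ 𝒜) (hB : ℬ.IsAcyclic) : 𝒜.IsAcyclic := by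
  obtain ⟨b, hb, hdb⟩ := hB.exists_d_eq_one
  exact DGStructure.isAcyclic_of_d_eq_one (φ.map_gr hb) (by rw [← φ.map_d, hdb, map_one])

theorem isDGSeparable_of_isGradedSeparableExt (hc : IsGradedCommutative 𝒜.gr)
    (hB : ℬ.IsAcyclic) (h : IsGradedSeparableExt φ.cyclesMap 𝒜.cyclesGr) : φ.IsDGSeparable := by
  obtain ⟨b, hb, hdb⟩ := hB.exists_d_eq_one
  obtain ⟨e, he, he0⟩ := isGradedSeparableExt_iff.1 h
  have hy := φ.map_gr hb
  have hdy : 𝒜.d (φ.toAlgHom b) = 1 := by rw [← φ.map_d, hdb, map_one]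
  have he0' : φ.cyclesTensorMap e ∈ tensorGrading φ.toAlgHom 𝒜.gr 0 :=
    BalTensor.map_mem_tensorGrading _ (fun _ _ hx => hx) he0
  refine φ.isDGSeparable_iff.2
    ⟨φ.cyclesTensorMap e, ⟨fun s => ?_, ?_⟩, he0', φ.tensorD_cyclesTensorMap e⟩
  · have hcyc : ∀ x : 𝒜.cycles, lmul φ.toAlgHom (x : A) (φ.cyclesTensorMap e) =
        rmul φ.toAlgHom (x : A) (φ.cyclesTensorMap e) := fun x => by
      have h1 := BalTensor.map_lmul (φ := φ.cyclesMap) (ψ := φ.toAlgHom) (f := 𝒜.cycles.val)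
        (fun r => ⟨(r : B), rfl⟩) x e
      have h2 := BalTensor.map_rmul (φ := φ.cyclesMap) (ψ := φ.toAlgHom) (f := 𝒜.cycles.val)
        (fun r => ⟨(r : B), rfl⟩) x e
      exact h1.symm.trans ((congrArg _ (he.lmul_eq_rmul x)).trans h2)
    -- `A = ker d + y ker d` for `y = φ b`
    have hs : s = (s - φ.toAlgHom b * 𝒜.d s) + φ.toAlgHom b * 𝒜.d s := (sub_add_cancel _ _).symm
    rw [hs, lmul_add, rmul_add, lmul_mul, rmul_mul,
      hcyc ⟨s - φ.toAlgHom b * 𝒜.d s, DGStructure.d_sub_mul_d hy hdy s⟩,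
      hcyc ⟨𝒜.d s, 𝒜.d_d s⟩, lmul_rmul, lmul_eq_rmul_of_mem_tensorGrading_zero hc hb he0']
  · exact (BalTensor.mulMap_map _ e).trans (by rw [he.mulMap_eq_one, map_one])

end

section

variable [Field K] [Algebra K A] [Algebra K B]
  {ℬ : DGStructure K B} {𝒜 : DGStructure K A} (φ : DGExtension ℬ 𝒜)

/-- The projections of `A` and `B` onto their cycles along `y ker d` are compatible, so that they
carry a separability idempotent of `A ⊗_B A` to one of `ker d_A ⊗ ker d_A`. -/
theorem isGradedSeparableExt_of_isDGSeparable (hc : IsGradedCommutative 𝒜.gr)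
    (h2 : ringChar K ≠ 2) (hB : ℬ.IsAcyclic) (h : φ.IsDGSeparable) :
    IsGradedSeparableExt φ.cyclesMap 𝒜.cyclesGr := by
  obtain ⟨b, hb, hdb⟩ := hB.exists_d_eq_one
  obtain ⟨e, he, he0, -⟩ := φ.isDGSeparable_iff.1 h
  have hy := φ.map_gr hb
  have hdy : 𝒜.d (φ.toAlgHom b) = 1 := by rw [← φ.map_d, hdb, map_one]
  have hyy := hc.mul_self_eq_zero_of_odd h2 (by decide) hy
  have hπ : ∀ r, ∃ r', DGStructure.cyclesProj hc hy hdy hyy (φ.toAlgHom r) = φ.cyclesMap r' := by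
    refine fun r => ⟨⟨r - b * ℬ.d r, DGStructure.d_sub_mul_d hb hdb r⟩, Subtype.ext ?_⟩
    rw [DGStructure.coe_cyclesProj, coe_cyclesMap, map_sub, map_mul, φ.map_d]
  refine isGradedSeparableExt_iff.2
    ⟨BalTensor.map φ.toAlgHom φ.cyclesMap (DGStructure.cyclesProj hc hy hdy hyy) hπ e,
      ⟨fun s => ?_, ?_⟩, BalTensor.map_mem_tensorGrading hπ
        (fun i x hx => DGStructure.cyclesProj_mem_cyclesGr hc hy hdy hyy hx) he0⟩
  · have h1 := BalTensor.map_lmul hπ (s : A) e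
    have h3 := BalTensor.map_rmul hπ (s : A) e
    rw [DGStructure.cyclesProj_of_mem_cycles] at h1 h3
    rw [← h1, ← h3, he.lmul_eq_rmul]
  · rw [BalTensor.mulMap_map, he.mulMap_eq_one, map_one]

/-- With `π x = x - y d x`, the map `Φ (x ⊗ z) = d x · π z` is well defined on `A ⊗_B A` because
`d_B = 0`. It satisfies `Φ (y w) = π (μ w)`, where `μ` is the multiplication, and `Φ (w y) = 0`, so
`y` does not commute with any `e` such that `μ e = 1`. -/
theorem not_isDGSeparable_of_d_eq_zero [Nontrivial A] (hc : IsGradedCommutative 𝒜.gr)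
    (h2 : ringChar K ≠ 2) (hB : ℬ.d = 0) (hA : 𝒜.IsAcyclic) : ¬ φ.IsDGSeparable := by
  intro h
  obtain ⟨y, hy, hdy⟩ := hA.exists_d_eq_one
  obtain ⟨e, he, -, -⟩ := φ.isDGSeparable_iff.1 h
  have hyy := hc.mul_self_eq_zero_of_odd h2 (by decide) hy
  set π : A →ₐ[K] A := 𝒜.cycles.val.comp (DGStructure.cyclesProj hc hy hdy hyy) with hπdef
  have hπ : ∀ x, π x = x - y * 𝒜.d x := fun _ => rfl
  have hdφ : ∀ r, 𝒜.d (φ.toAlgHom r) = 0 := fun r => by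
    rw [← φ.map_d, hB, LinearMap.zero_apply, map_zero]
  let Φ : BalTensor φ.toAlgHom →ₗ[K] A := BalTensor.lift φ.toAlgHom
    ((LinearMap.mul K A).compl₁₂ 𝒜.d π.toLinearMap) (fun x r z => by
      change 𝒜.d (x * φ.toAlgHom r) * π z = 𝒜.d x * π (φ.toAlgHom r * z)
      rw [𝒜.d_mul, hdφ, mul_zero, add_zero, map_mul, hπ (φ.toAlgHom r), hdφ, mul_zero, sub_zero,
        mul_assoc])
  have hΦ : ∀ x z, Φ (tmul φ.toAlgHom x z) = 𝒜.d x * π z := fun _ _ => rfl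
  have hl : ∀ w, Φ (lmul φ.toAlgHom y w) = π (mulMap φ.toAlgHom w) := fun w => by
    induction w using BalTensor.induction_on with
    | zero => simp
    | tmul x z =>
      rw [lmul_tmul, hΦ, DGStructure.d_mul_of_mem_neg_one hy hdy, mulMap_tmul, map_mul, hπ x]
    | add z w hz hw => simp only [map_add, hz, hw]
  have hr : ∀ w, Φ (rmul φ.toAlgHom y w) = 0 := fun w => by
    induction w using BalTensor.induction_on with
    | zero => simp
    | tmul x z => rw [rmul_tmul, hΦ, map_mul, hπ y, hdy, mul_one, sub_self, mul_zero, mul_zero]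
    | add z w hz hw => simp only [map_add, hz, hw, add_zero]
  have := hl e
  rw [he.lmul_eq_rmul, hr, he.mulMap_eq_one, map_one] at this
  exact zero_ne_one this

end

end DGExtension

/-! ### Graded-commutative gr-division rings -/

section GradedDivision

theorem zpow_mem_graded {K C : Type*} [CommRing K] [Ring C] [Algebra K C] {𝒞 : ℤ → Submodule K C}
    [SetLike.GradedMonoid 𝒞] {m : ℤ} {u : Cˣ} (hu : (u : C) ∈ 𝒞 m)
    (hui : ((u⁻¹ : Cˣ) : C) ∈ 𝒞 (-m)) (n : ℤ) : ((u ^ n : Cˣ) : C) ∈ 𝒞 (m * n) := by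
  obtain ⟨k, rfl | rfl⟩ := n.eq_nat_or_neg
  · have := SetLike.pow_mem_graded k hu
    rwa [nsmul_eq_mul, mul_comm, ← Units.val_pow_eq_pow_val, ← zpow_natCast] at this
  · have := SetLike.pow_mem_graded k hui
    rwa [nsmul_eq_mul, mul_neg, mul_comm, ← mul_neg, mul_neg, ← mul_neg,
      ← Units.val_pow_eq_pow_val, inv_pow, ← zpow_natCast, ← zpow_neg] at this

variable {K C : Type*} [Field K] [Ring C] [Algebra K C] {𝒞 : ℤ → Submodule K C} [GradedAlgebra 𝒞]

theorem eq_zero_of_mem_of_odd (hc : IsGradedCommutative 𝒞) (hd : IsGradedDivision 𝒞)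
    (h2 : ringChar K ≠ 2) {i : ℤ} (hi : Odd i) {a : C} (ha : a ∈ 𝒞 i) : a = 0 := by
  by_contra h0
  exact h0 ((hd.2 ha h0).mul_right_eq_zero.1 (hc.mul_self_eq_zero_of_odd h2 hi ha))

theorem mul_comm_of_isGradedDivision (hc : IsGradedCommutative 𝒞) (hd : IsGradedDivision 𝒞)
    (h2 : ringChar K ≠ 2) (x y : C) : x * y = y * x := by
  have key : ∀ i, ∀ a ∈ 𝒞 i, ∀ j, ∀ b ∈ 𝒞 j, a * b = b * a := by
    intro i a ha j b hb
    rcases Int.even_or_odd i with hi | hi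
    · rw [hc ha hb, Int.negOnePow_even _ (hi.mul_right j), one_smul]
    · rw [eq_zero_of_mem_of_odd hc hd h2 hi ha, zero_mul, mul_zero]
  refine ext_homogeneous 𝒞 (f := AddMonoidHom.mulRight y) (g := AddMonoidHom.mulLeft y)
    (fun i a ha => ?_) x
  exact ext_homogeneous 𝒞 (f := AddMonoidHom.mulLeft a) (g := AddMonoidHom.mulRight a)
    (fun j b hb => key i a ha j b hb) y

theorem IsGradedDivision.exists_unit (hd : IsGradedDivision 𝒞) {i : ℤ} {a : C} (ha : a ∈ 𝒞 i)
    (h0 : a ≠ 0) : ∃ u : Cˣ, (u : C) = a ∧ ((u⁻¹ : Cˣ) : C) ∈ 𝒞 (-i) := by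
  obtain ⟨u, hu⟩ := hd.2 ha h0
  have h1 := decompose_neg_mul_eq_one 𝒞 ha (x := ((u⁻¹ : Cˣ) : C)) (by rw [← hu, Units.inv_mul])
  refine ⟨u, hu, ?_⟩
  rw [← hu] at h1
  rw [Units.inv_eq_of_mul_eq_one_left h1]
  exact SetLike.coe_mem _

/-- The degrees of the nonzero homogeneous elements of a gr-division ring. -/
def IsGradedDivision.support (hd : IsGradedDivision 𝒞) : AddSubgroup ℤ where
  carrier := {i | ∃ a ∈ 𝒞 i, a ≠ 0}
  zero_mem' := ⟨1, SetLike.GradedOne.one_mem, have := hd.1; one_ne_zero⟩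
  add_mem' := by
    rintro i j ⟨a, ha, ha0⟩ ⟨b, hb, hb0⟩
    exact ⟨a * b, SetLike.mul_mem_graded ha hb,
      fun h => hb0 ((hd.2 ha ha0).mul_right_eq_zero.1 h)⟩
  neg_mem' := by
    rintro i ⟨a, ha, ha0⟩
    obtain ⟨u, -, hu⟩ := hd.exists_unit ha ha0
    have := hd.1
    exact ⟨_, hu, Units.ne_zero _⟩

/-- A commutative graded algebra is a Laurent polynomial algebra over its degree `0` part `D` if
its support is `m ℤ` with `m ≠ 0` and a unit `u` has degree `m`: the isomorphism sends `T` to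
`u`. -/
theorem exists_algEquiv_laurent {D : Type*} [Field D] [Algebra K D] [Nontrivial C]
    (hcomm : ∀ x y : C, x * y = y * x) (f : D →ₐ[K] C) (hf0 : ∀ x, x ∈ 𝒞 0 ↔ ∃ d, f d = x)
    {m : ℤ} (hm : m ≠ 0) {u : Cˣ} (hu : (u : C) ∈ 𝒞 m) (hui : ((u⁻¹ : Cˣ) : C) ∈ 𝒞 (-m))
    (hsupp : ∀ i, ∀ x ∈ 𝒞 i, x ≠ 0 → m ∣ i) :
    ∃ e : C ≃ₐ[K] LaurentPolynomial D, ∀ k x, x ∈ 𝒞 k ↔ e x ∈ laurentGrading D m k := by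
  classical
  let F : LaurentPolynomial D →ₐ[K] C := AddMonoidAlgebra.liftNCAlgHom f
    ((Units.coeHom C).comp (zpowersHom Cˣ u)) (fun _ _ => hcomm _ _)
  have hF : ∀ (n : ℤ) (a : D), F (.single n a) = f a * ((u ^ n : Cˣ) : C) := fun n a => by
    change AddMonoidAlgebra.liftNC _ _ (AddMonoidAlgebra.single n a) = _
    rw [AddMonoidAlgebra.liftNC_single]
    rfl
  have hmem : ∀ (n : ℤ) (a : D), f a * ((u ^ n : Cˣ) : C) ∈ 𝒞 (m * n) := fun n a => by
    have := SetLike.mul_mem_graded ((hf0 _).2 ⟨a, rfl⟩) (zpow_mem_graded hu hui n)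
    rwa [zero_add] at this
  have hcoeff : ∀ (p : LaurentPolynomial D) (n : ℤ),
      (DirectSum.decompose 𝒞 (F p) (m * n) : C) = f (p.coeff n) * ((u ^ n : Cˣ) : C) := by
    intro p n
    induction p using LaurentPolynomial.induction_on' with
    | add p q hp hq => simp [hp, hq, add_mul]
    | C_mul_T j a =>
      rw [← LaurentPolynomial.single_eq_C_mul_T, hF]
      by_cases h : j = n
      · subst h
        rw [DirectSum.decompose_of_mem_same _ (hmem j a), AddMonoidAlgebra.coeff_single,
          Finsupp.single_eq_same]
      · rw [DirectSum.decompose_of_mem_ne _ (hmem j a) (fun e => h (mul_left_cancel₀ hm e)),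
          AddMonoidAlgebra.coeff_single, Finsupp.single_eq_of_ne' h, map_zero, zero_mul]
  have hinj : Function.Injective F := by
    rw [injective_iff_map_eq_zero]
    intro p hp
    refine LaurentPolynomial.ext fun n => ?_
    have h1 := hcoeff p n
    rw [hp, DirectSum.decompose_zero, DirectSum.zero_apply, ZeroMemClass.coe_zero, eq_comm,
      Units.mul_left_eq_zero, map_eq_zero_iff f f.toRingHom.injective] at h1
    simpa using h1
  have hgr : ∀ k, ∀ p ∈ laurentGrading D m k, F p ∈ 𝒞 k := by
    intro k p hp
    rw [← AddMonoidAlgebra.sum_coeff_single p, Finsupp.sum, map_sum]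
    refine sum_mem fun n hn => ?_
    have h1 : m * n = k := hp n hn
    rw [hF, ← h1]
    exact hmem n _
  have hlift : ∀ k, ∀ x ∈ 𝒞 k, ∃ p ∈ laurentGrading D m k, F p = x := by
    intro k x hx
    by_cases h0 : x = 0
    · exact ⟨0, zero_mem _, by rw [map_zero, h0]⟩
    · obtain ⟨n, rfl⟩ := hsupp k x hx h0
      have h1 : x * ((u ^ (-n) : Cˣ) : C) ∈ 𝒞 0 := by
        have := SetLike.mul_mem_graded hx (zpow_mem_graded hu hui (-n))
        rwa [mul_neg, add_neg_cancel] at this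
      obtain ⟨d, hd⟩ := (hf0 _).1 h1
      refine ⟨.single n d, AddMonoidAlgebra.single_mem_gradeBy _ n d, ?_⟩
      rw [hF, hd, mul_assoc, ← Units.val_mul, ← zpow_add, neg_add_cancel, zpow_zero, Units.val_one,
        mul_one]
  have hsurj : Function.Surjective F := by
    intro x
    have h1 : x ∈ F.range := by
      rw [← DirectSum.sum_support_decompose 𝒞 x]
      refine sum_mem fun i _ => ?_
      obtain ⟨p, -, hp⟩ := hlift i _ (SetLike.coe_mem (DirectSum.decompose 𝒞 x i))
      exact ⟨p, hp⟩
    exact h1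
  let e := AlgEquiv.ofBijective F ⟨hinj, hsurj⟩
  refine ⟨e.symm, fun k x => ⟨fun hx => ?_, fun hx => ?_⟩⟩
  · obtain ⟨p, hp, rfl⟩ := hlift k x hx
    rwa [show F p = e p from rfl, AlgEquiv.symm_apply_apply]
  · have := hgr k _ hx
    rwa [show F (e.symm x) = e (e.symm x) from rfl, AlgEquiv.apply_symm_apply] at this

end GradedDivision

theorem isField_or_exists_algEquiv_laurent {K : Type uK} {C : Type uC} [Field K] [Ring C]
    [Algebra K C] (𝒞 : ℤ → Submodule K C) [GradedAlgebra 𝒞] (hc : IsGradedCommutative 𝒞)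
    (hd : IsGradedDivision 𝒞) (h2 : ringChar K ≠ 2) :
    (IsField C ∧ 𝒞 0 = ⊤) ∨
      ∃ (D : Type uC) (_ : Field D) (_ : Algebra K D) (m : ℤ) (e : C ≃ₐ[K] LaurentPolynomial D),
        m ≠ 0 ∧ Even m ∧ ∀ (k : ℤ) (x : C), x ∈ 𝒞 k ↔ e x ∈ laurentGrading D m k := by
  classical
  have hnt := hd.1
  have hcomm := mul_comm_of_isGradedDivision hc hd h2
  obtain ⟨m, hm⟩ := Int.subgroup_cyclic hd.support
  have hsupp : ∀ i, ∀ x ∈ 𝒞 i, x ≠ 0 → m ∣ i := fun i x hx h0 => by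
    have h1 : i ∈ hd.support := ⟨x, hx, h0⟩
    rwa [hm, ← AddSubgroup.zmultiples_eq_closure, Int.mem_zmultiples_iff] at h1
  by_cases hm0 : m = 0
  · left
    have h0 : 𝒞 0 = ⊤ := by
      refine eq_top_iff.2 fun x _ => ?_
      rw [← DirectSum.sum_support_decompose 𝒞 x]
      refine sum_mem fun i hi => ?_
      have h1 : (DirectSum.decompose 𝒞 x i : C) ≠ 0 := fun e =>
        (DFinsupp.mem_support_iff.1 hi) (Subtype.ext e)
      have h3 := hsupp i _ (SetLike.coe_mem _) h1
      rw [hm0, zero_dvd_iff] at h3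
      subst h3
      exact SetLike.coe_mem _
    refine ⟨⟨⟨0, 1, zero_ne_one⟩, hcomm, fun {a} ha => ?_⟩, h0⟩
    exact (hd.2 (i := 0) (h0 ▸ Submodule.mem_top) ha).exists_right_inv
  · right
    have hms : m ∈ hd.support := by rw [hm]; exact AddSubgroup.subset_closure rfl
    obtain ⟨a, ha, ha0⟩ := hms
    obtain ⟨u, rfl, hui⟩ := hd.exists_unit ha ha0
    have hfield : IsField (SetLike.GradeZero.subalgebra 𝒞) := by
      refine ⟨⟨0, 1, zero_ne_one⟩, fun x y => Subtype.ext (hcomm _ _), fun {a} h0 => ?_⟩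
      obtain ⟨v, hv, hvi⟩ := hd.exists_unit (i := 0) a.2 (fun e => h0 (Subtype.ext e))
      rw [neg_zero] at hvi
      exact ⟨⟨_, hvi⟩, Subtype.ext (by
        change (a : C) * ((v⁻¹ : Cˣ) : C) = 1
        rw [← hv, Units.mul_inv])⟩
    let := hfield.toField
    obtain ⟨e, he⟩ := exists_algEquiv_laurent (D := SetLike.GradeZero.subalgebra 𝒞) hcomm
      (SetLike.GradeZero.subalgebra 𝒞).val (fun x => ⟨fun hx => ⟨⟨x, hx⟩, rfl⟩, by
        rintro ⟨d, rfl⟩; exact d.2⟩) hm0 ha hui hsupp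
    refine ⟨SetLike.GradeZero.subalgebra 𝒞, inferInstance, inferInstance, m, e, hm0, ?_, he⟩
    by_contra hodd
    exact ha0 (eq_zero_of_mem_of_odd hc hd h2 (Int.not_even_iff_odd.1 hodd) ha)

/-! ### Extensions of Laurent polynomial rings -/

section Laurent

open LaurentPolynomial

instance laurentGrading.gradedMonoid (D : Type*) [Field D] (m : ℤ) :
    SetLike.GradedMonoid (laurentGrading D m) :=
  AddMonoidAlgebra.gradeBy.gradedMonoid (AddMonoidHom.mulLeft m)

theorem C_mul_T_mem_laurentGrading {D : Type*} [Field D] (m n : ℤ) (a : D) :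
    C a * T n ∈ laurentGrading D m (m * n) := by
  rw [← single_eq_C_mul_T]
  exact AddMonoidAlgebra.single_mem_gradeBy _ n a

variable {D₁ D₂ : Type*} [Field D₁] [Field D₂] [Algebra D₁ D₂] {n : ℤ}

theorem T_natAbs_mem_laurentSub : (T (n.natAbs : ℤ) : D₂[T;T⁻¹]) ∈ laurentSub D₁ D₂ n := by
  rcases n.natAbs_eq with h | h
  · rw [← h]
    exact Algebra.subset_adjoin (Or.inl rfl)
  · rw [show (n.natAbs : ℤ) = -n by omega]
    exact Algebra.subset_adjoin (Or.inr rfl)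

/-! ### From the coefficient fields to Laurent polynomials -/

variable (D₁ D₂) in
/-- The map `D₂ ⊗ D₂ → D₂[T, T⁻¹] ⊗ D₂[T, T⁻¹]`, with tensor products over `D₁` and
`D₁[Tⁿ, T⁻ⁿ]`. -/
noncomputable def constTensor (n : ℤ) :
    BalTensor (Algebra.ofId D₁ D₂) →ₗ[D₁] BalTensor (laurentSub D₁ D₂ n).val :=
  BalTensor.map _ _ (IsScalarTower.toAlgHom D₁ D₂ D₂[T;T⁻¹])
    (fun r => ⟨algebraMap D₁ _ r, (IsScalarTower.algebraMap_apply D₁ D₂ D₂[T;T⁻¹] r).symm⟩)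

theorem constTensor_tmul (x y : D₂) :
    constTensor D₁ D₂ n (tmul _ x y) = tmul (laurentSub D₁ D₂ n).val (C x) (C y) := rfl

variable (D₁ D₂ n) in
/-- The element `T^j z T^{-j}` of the bimodule `D₂[T, T⁻¹] ⊗ D₂[T, T⁻¹]`. -/
noncomputable def conjT (j : ℤ) :
    BalTensor (laurentSub D₁ D₂ n).val →ₗ[D₁] BalTensor (laurentSub D₁ D₂ n).val :=
  lmul (laurentSub D₁ D₂ n).val (T j) ∘ₗ rmul (laurentSub D₁ D₂ n).val (T (-j))

theorem conjT_apply (j : ℤ) (z : BalTensor (laurentSub D₁ D₂ n).val) :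
    conjT D₁ D₂ n j z =
      lmul (laurentSub D₁ D₂ n).val (T j) (rmul (laurentSub D₁ D₂ n).val (T (-j)) z) := rfl

theorem conjT_zero (z : BalTensor (laurentSub D₁ D₂ n).val) : conjT D₁ D₂ n 0 z = z := by
  rw [conjT_apply, neg_zero, T_zero, lmul_one, rmul_one]

theorem conjT_natAbs_constTensor (z : BalTensor (Algebra.ofId D₁ D₂)) :
    conjT D₁ D₂ n (n.natAbs : ℤ) (constTensor D₁ D₂ n z) = constTensor D₁ D₂ n z := by
  induction z using BalTensor.induction_on with
  | zero => simp
  | tmul x y =>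
    have h := tmul_balanced (laurentSub D₁ D₂ n).val (C x) ⟨_, T_natAbs_mem_laurentSub⟩
      (T (-(n.natAbs : ℤ)) * C y)
    rw [constTensor_tmul, conjT_apply, rmul_tmul, lmul_tmul, T_mul, ← T_mul (-(n.natAbs : ℤ))]
    refine h.trans (congrArg _ ?_)
    change T (n.natAbs : ℤ) * (T (-(n.natAbs : ℤ)) * C y) = C y
    rw [← mul_assoc, ← T_add, add_neg_cancel, T_zero, one_mul]
  | add z w hz hw => rw [map_add, map_add, hz, hw]

theorem conjT_constTensor_mem (m j : ℤ) (z : BalTensor (Algebra.ofId D₁ D₂)) :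
    conjT D₁ D₂ n j (constTensor D₁ D₂ n z) ∈
      tensorGrading (laurentSub D₁ D₂ n).val (laurentGrading D₂ m) 0 := by
  induction z using BalTensor.induction_on with
  | zero => rw [map_zero, map_zero]; exact zero_mem _
  | tmul x y =>
    rw [constTensor_tmul, conjT_apply, rmul_tmul, lmul_tmul, T_mul]
    exact Submodule.subset_span ⟨m * j, m * -j, _, _, by ring, C_mul_T_mem_laurentGrading m j x,
      C_mul_T_mem_laurentGrading m (-j) y, rfl⟩
  | add z w hz hw => rw [map_add, map_add]; exact add_mem hz hw

theorem lmul_C_conjT (j : ℤ) (a : D₂) (z : BalTensor (laurentSub D₁ D₂ n).val) :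
    lmul (laurentSub D₁ D₂ n).val (C a) (conjT D₁ D₂ n j z) =
      conjT D₁ D₂ n j (lmul (laurentSub D₁ D₂ n).val (C a) z) := by
  rw [conjT_apply, conjT_apply, ← lmul_mul, ← T_mul, lmul_mul, lmul_rmul]

theorem rmul_C_conjT (j : ℤ) (a : D₂) (z : BalTensor (laurentSub D₁ D₂ n).val) :
    rmul (laurentSub D₁ D₂ n).val (C a) (conjT D₁ D₂ n j z) =
      conjT D₁ D₂ n j (rmul (laurentSub D₁ D₂ n).val (C a) z) := by
  rw [conjT_apply, conjT_apply, ← lmul_rmul, ← rmul_mul, T_mul, rmul_mul]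

theorem lmul_T_conjT (j : ℤ) (z : BalTensor (laurentSub D₁ D₂ n).val) :
    lmul (laurentSub D₁ D₂ n).val (T 1) (conjT D₁ D₂ n j z) =
      rmul (laurentSub D₁ D₂ n).val (T 1) (conjT D₁ D₂ n (j + 1) z) := by
  rw [conjT_apply, conjT_apply, ← lmul_mul, ← T_add, ← lmul_rmul, ← rmul_mul, ← T_add, add_comm 1 j,
    neg_add_rev, add_comm (-1 : ℤ), neg_add_cancel_right]

theorem mulMap_conjT (j : ℤ) (z : BalTensor (laurentSub D₁ D₂ n).val) :
    mulMap (laurentSub D₁ D₂ n).val (conjT D₁ D₂ n j z) = mulMap (laurentSub D₁ D₂ n).val z := by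
  induction z using BalTensor.induction_on with
  | zero => simp
  | tmul x y =>
    rw [conjT_apply, rmul_tmul, lmul_tmul, mulMap_tmul, mulMap_tmul, T_mul, ← T_mul (-j), mul_assoc,
      ← mul_assoc (T j), ← T_add, add_neg_cancel, T_zero, one_mul]
  | add z w hz hw => simp only [map_add, hz, hw]

/-- An element of `D₂[T, T⁻¹] ⊗ D₂[T, T⁻¹]` that commutes with the constants and with `T` commutes
with every Laurent polynomial. -/
theorem lmul_eq_rmul_of_C_of_T {e : BalTensor (laurentSub D₁ D₂ n).val}
    (hC : ∀ a, lmul (laurentSub D₁ D₂ n).val (C a) e = rmul (laurentSub D₁ D₂ n).val (C a) e)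
    (hT : lmul (laurentSub D₁ D₂ n).val (T 1) e = rmul (laurentSub D₁ D₂ n).val (T 1) e)
    (s : D₂[T;T⁻¹]) : lmul (laurentSub D₁ D₂ n).val s e = rmul (laurentSub D₁ D₂ n).val s e := by
  have hmul : ∀ s t, lmul (laurentSub D₁ D₂ n).val s e = rmul (laurentSub D₁ D₂ n).val s e →
      lmul (laurentSub D₁ D₂ n).val t e = rmul (laurentSub D₁ D₂ n).val t e →
      lmul (laurentSub D₁ D₂ n).val (s * t) e = rmul (laurentSub D₁ D₂ n).val (s * t) e :=
        fun s t hs ht => by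
    rw [lmul_mul, ht, lmul_rmul, hs, rmul_mul]
  have hTi : lmul (laurentSub D₁ D₂ n).val (T (-1)) e =
      rmul (laurentSub D₁ D₂ n).val (T (-1)) e := by
    have h1 := congrArg
      (fun z => lmul (laurentSub D₁ D₂ n).val (T (-1))
        (rmul (laurentSub D₁ D₂ n).val (T (-1)) z)) hT
    simp only [← lmul_rmul _ _ e] at h1
    simp only [lmul_rmul, ← lmul_mul, ← rmul_mul, ← T_add] at h1
    simpa only [neg_add_cancel, add_neg_cancel, T_zero, lmul_one, rmul_one, lmul_rmul] using h1.symm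
  induction s using LaurentPolynomial.induction_on with
  | h_C a => exact hC a
  | h_add hp hq => rw [lmul_add, rmul_add, hp, hq]
  | h_C_mul_T k a h => rw [T_add, ← mul_assoc]; exact hmul _ _ h hT
  | h_C_mul_T_Z k a h => rw [sub_eq_add_neg, T_add, ← mul_assoc]; exact hmul _ _ h hTi

/-- If `e₀` is a separability idempotent of `D₁ ⊆ D₂` and `n` is invertible, then
`|n|⁻¹ ∑ T^j e₀ T^{-j}`, `0 ≤ j < |n|`, is one of `D₁[Tⁿ, T⁻ⁿ] ⊆ D₂[T, T⁻¹]`. -/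
theorem isGradedSeparableExt_laurentSub (m : ℤ) (h : IsSeparableExt (Algebra.ofId D₁ D₂))
    (hn : (n.natAbs : D₁) ≠ 0) :
    IsGradedSeparableExt (laurentSub D₁ D₂ n).val (laurentGrading D₂ m) := by
  obtain ⟨e₀, he₀⟩ := isSeparableExt_iff.1 h
  set z := constTensor D₁ D₂ n e₀ with hz
  have hCz : ∀ a, lmul (laurentSub D₁ D₂ n).val (C a) z = rmul (laurentSub D₁ D₂ n).val (C a) z :=
      fun a => by
    have h1 := BalTensor.map_lmul (ψ := (laurentSub D₁ D₂ n).val)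
      (f := IsScalarTower.toAlgHom D₁ D₂ D₂[T;T⁻¹])
      (fun r => ⟨algebraMap D₁ _ r, (IsScalarTower.algebraMap_apply D₁ D₂ D₂[T;T⁻¹] r).symm⟩) a e₀
    have h2 := BalTensor.map_rmul (ψ := (laurentSub D₁ D₂ n).val)
      (f := IsScalarTower.toAlgHom D₁ D₂ D₂[T;T⁻¹])
      (fun r => ⟨algebraMap D₁ _ r, (IsScalarTower.algebraMap_apply D₁ D₂ D₂[T;T⁻¹] r).symm⟩) a e₀
    exact h1.symm.trans ((congrArg _ (he₀.lmul_eq_rmul a)).trans h2)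
  have hμz : mulMap (laurentSub D₁ D₂ n).val z = 1 :=
    (BalTensor.mulMap_map _ e₀).trans (by rw [he₀.mulMap_eq_one, map_one])
  refine isGradedSeparableExt_iff.2
    ⟨(n.natAbs : D₁)⁻¹ • ∑ j ∈ Finset.range n.natAbs, conjT D₁ D₂ n (j : ℤ) z,
      ⟨lmul_eq_rmul_of_C_of_T (fun a => ?_) ?_, ?_⟩,
      Submodule.smul_mem _ _ (sum_mem fun j _ => conjT_constTensor_mem m j e₀)⟩
  · simp only [map_smul, map_sum, lmul_C_conjT, rmul_C_conjT, hCz]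
  · -- the sum is invariant under the shift of `j` because `T^{|n|} z T^{-|n|} = z`
    have hshift : ∑ j ∈ Finset.range n.natAbs, conjT D₁ D₂ n ((j : ℤ) + 1) z =
        ∑ j ∈ Finset.range n.natAbs, conjT D₁ D₂ n (j : ℤ) z := by
      have h1 := Finset.sum_range_succ (fun j : ℕ => conjT D₁ D₂ n (j : ℤ) z) n.natAbs
      rw [Finset.sum_range_succ'] at h1
      simp only [Nat.cast_add, Nat.cast_one, Nat.cast_zero, conjT_zero] at h1
      rw [hz, conjT_natAbs_constTensor, ← hz] at h1
      exact add_right_cancel h1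
    simp only [map_smul, map_sum, lmul_T_conjT]
    rw [← map_sum, hshift, map_sum]
  · simp only [map_smul, map_sum, mulMap_conjT, hμz, Finset.sum_const, Finset.card_range]
    rw [← Nat.cast_smul_eq_nsmul D₁, smul_smul, inv_mul_cancel₀ hn, one_smul]

/-! ### From Laurent polynomials to the coefficient fields -/

variable (D₁ D₂) in
/-- The coefficient of `T^j`, as a `D₁`-linear map. -/
noncomputable def coeffHom (j : ℤ) : D₂[T;T⁻¹] →ₗ[D₁] D₂ :=
  Finsupp.lapply j ∘ₗ (AddMonoidAlgebra.coeffLinearEquiv D₁).toLinearMap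

variable (D₁ D₂) in
/-- The bilinear map `(a, q) ↦ a ⊗ b`, where `b` is the coefficient of `T^{-i}` in `q`, if `n ∣ i`,
and `0` otherwise. -/
noncomputable def residueAux (n i : ℤ) :
    D₂ →ₗ[D₁] D₂[T;T⁻¹] →ₗ[D₁] BalTensor (Algebra.ofId D₁ D₂) :=
  if n ∣ i then
    ((TensorProduct.mk D₁ D₂ D₂).compr₂ (balancedRel (Algebra.ofId D₁ D₂)).mkQ).compl₂
      (coeffHom D₁ D₂ (-i))
  else 0

variable (D₁ D₂) in
/-- The bilinear map `(a T^i, b T^j) ↦ a ⊗ b` if `i + j = 0` and `n ∣ i`, and `0` otherwise. -/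
noncomputable def residueBilin (n : ℤ) :
    D₂[T;T⁻¹] →ₗ[D₁] D₂[T;T⁻¹] →ₗ[D₁] BalTensor (Algebra.ofId D₁ D₂) :=
  Finsupp.lsum D₁ (residueAux D₁ D₂ n) ∘ₗ (AddMonoidAlgebra.coeffLinearEquiv D₁).toLinearMap

theorem residueBilin_single (n i : ℤ) (a : D₂) (q : D₂[T;T⁻¹]) :
    residueBilin D₁ D₂ n (.single i a) q =
      if n ∣ i then tmul (Algebra.ofId D₁ D₂) a (q.coeff (-i)) else 0 := by
  have h1 : residueBilin D₁ D₂ n (.single i a) = residueAux D₁ D₂ n i a :=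
    Finsupp.lsum_single D₁ (residueAux D₁ D₂ n) i a
  rw [h1, residueAux]
  split_ifs <;> rfl

theorem residueBilin_mul_T {l : ℤ} (hl : n ∣ l) (x y : D₂[T;T⁻¹]) :
    residueBilin D₁ D₂ n (x * T l) y = residueBilin D₁ D₂ n x (T l * y) := by
  induction x using LaurentPolynomial.induction_on' with
  | add p q hp hq =>
    rw [add_mul, map_add, map_add, LinearMap.add_apply, LinearMap.add_apply, hp, hq]
  | C_mul_T i a =>
    rw [mul_T_assoc, ← single_eq_C_mul_T, ← single_eq_C_mul_T, residueBilin_single,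
      residueBilin_single, T, AddMonoidAlgebra.coeff_single_mul_apply, one_mul]
    simp only [dvd_add_left hl, neg_add_rev]

theorem residueBilin_mul_algebraMap (r : D₁) (x y : D₂[T;T⁻¹]) :
    residueBilin D₁ D₂ n (x * algebraMap D₁ _ r) y =
      residueBilin D₁ D₂ n x (algebraMap D₁ _ r * y) := by
  rw [← Algebra.commutes, ← Algebra.smul_def, ← Algebra.smul_def, map_smul, map_smul,
    LinearMap.smul_apply]

theorem residueBilin_balanced (x : D₂[T;T⁻¹]) (r : laurentSub D₁ D₂ n) (y : D₂[T;T⁻¹]) :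
    residueBilin D₁ D₂ n (x * (laurentSub D₁ D₂ n).val r) y =
      residueBilin D₁ D₂ n x ((laurentSub D₁ D₂ n).val r * y) := by
  obtain ⟨r, hr⟩ := r
  change residueBilin D₁ D₂ n (x * r) y = residueBilin D₁ D₂ n x (r * y)
  induction hr using Algebra.adjoin_induction generalizing x y with
  | mem r hr =>
    obtain rfl | rfl := hr
    · exact residueBilin_mul_T dvd_rfl x y
    · exact residueBilin_mul_T (dvd_neg.2 dvd_rfl) x y
  | algebraMap r => exact residueBilin_mul_algebraMap r x y
  | add r s _ _ hr hs =>
    rw [mul_add, add_mul, map_add, map_add, LinearMap.add_apply, hr, hs]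
  | mul r s _ _ hr hs => rw [← mul_assoc, hs, hr, mul_assoc]

variable (D₁ D₂) in
/-- The map `D₂[T, T⁻¹] ⊗ D₂[T, T⁻¹] → D₂ ⊗ D₂` that sends `a T^i ⊗ b T^j` to `a ⊗ b` if `i + j = 0`
and `n ∣ i`, and to `0` otherwise. -/
noncomputable def residue (n : ℤ) :
    BalTensor (laurentSub D₁ D₂ n).val →ₗ[D₁] BalTensor (Algebra.ofId D₁ D₂) :=
  BalTensor.lift _ (residueBilin D₁ D₂ n) residueBilin_balanced

theorem residue_tmul (x y : D₂[T;T⁻¹]) :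
    residue D₁ D₂ n (tmul _ x y) = residueBilin D₁ D₂ n x y := rfl

/-- Induction on elements of `D₂[T, T⁻¹] ⊗ D₂[T, T⁻¹]` by monomials. -/
theorem laurentTensor_induction {p : BalTensor (laurentSub D₁ D₂ n).val → Prop}
    (z : BalTensor (laurentSub D₁ D₂ n).val)
    (single : ∀ i a j b, p (tmul (laurentSub D₁ D₂ n).val (.single i a) (.single j b)))
    (add : ∀ z w, p z → p w → p (z + w)) : p z := by
  induction z using BalTensor.induction_on with
  | zero =>
    have := single 0 0 0 0
    rwa [tmul, AddMonoidAlgebra.single_zero, TensorProduct.zero_tmul, map_zero] at this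
  | tmul x y =>
    induction x using LaurentPolynomial.induction_on' with
    | add x x' hx hx' => rw [tmul_add_left]; exact add _ _ hx hx'
    | C_mul_T i a =>
      induction y using LaurentPolynomial.induction_on' with
      | add y y' hy hy' => rw [tmul_add_right]; exact add _ _ hy hy'
      | C_mul_T j b => rw [← single_eq_C_mul_T, ← single_eq_C_mul_T]; exact single i a j b
  | add z w hz hw => exact add z w hz hw

theorem residue_lmul_C (c : D₂) (z : BalTensor (laurentSub D₁ D₂ n).val) :
    residue D₁ D₂ n (lmul (laurentSub D₁ D₂ n).val (C c) z) =
      lmul (Algebra.ofId D₁ D₂) c (residue D₁ D₂ n z) := by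
  induction z using laurentTensor_induction with
  | single i a j b =>
    rw [lmul_tmul, residue_tmul, residue_tmul, ← single_eq_C, AddMonoidAlgebra.single_mul_single,
      zero_add, residueBilin_single, residueBilin_single]
    split_ifs
    · rfl
    · rw [map_zero]
  | add z w hz hw => simp only [map_add, hz, hw]

theorem residue_rmul_C (c : D₂) (z : BalTensor (laurentSub D₁ D₂ n).val) :
    residue D₁ D₂ n (rmul (laurentSub D₁ D₂ n).val (C c) z) =
      rmul (Algebra.ofId D₁ D₂) c (residue D₁ D₂ n z) := by
  induction z using laurentTensor_induction with
  | single i a j b =>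
    rw [rmul_tmul, residue_tmul, residue_tmul, ← single_eq_C, residueBilin_single,
      residueBilin_single, AddMonoidAlgebra.coeff_mul_single_apply, neg_zero, add_zero]
    split_ifs
    · rfl
    · rw [map_zero]
  | add z w hz hw => simp only [map_add, hz, hw]

theorem sum_range_ite_dvd_sub {M : Type*} [AddCommMonoid M] {N : ℕ} (hN : N ≠ 0) (k : ℤ) (c : M) :
    ∑ i ∈ Finset.range N, (if (N : ℤ) ∣ k - i then c else 0) = c := by
  have hN' : (0 : ℤ) < N := by omega
  have h0 := Int.emod_nonneg k hN'.ne'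
  have h1 := Int.emod_lt_of_pos k hN'
  rw [Finset.sum_eq_single (k % N).toNat]
  · rw [if_pos]
    rw [Int.toNat_of_nonneg h0]
    exact Int.dvd_self_sub_emod
  · intro i hi hne
    rw [if_neg]
    intro hdvd
    apply hne
    have h2 : k % N = (i : ℤ) % N :=
      Int.emod_eq_emod_iff_emod_sub_eq_zero.2 (Int.emod_eq_zero_of_dvd hdvd)
    rw [h2, Int.emod_eq_of_lt (by omega) (by have := Finset.mem_range.1 hi; omega)]
    simp
  · intro h
    exact absurd (Finset.mem_range.2 (by omega)) h

/-- Each monomial `a T^k ⊗ b T^{-k}` is seen by `residue` after exactly one of the conjugations by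
`T^i`, `0 ≤ i < |n|`. -/
theorem coeff_mulMap_eq_sum (hn : n ≠ 0) (z : BalTensor (laurentSub D₁ D₂ n).val) :
    (mulMap (laurentSub D₁ D₂ n).val z).coeff 0 =
      ∑ i ∈ Finset.range n.natAbs,
        mulMap (Algebra.ofId D₁ D₂) (residue D₁ D₂ n (conjT D₁ D₂ n (-(i : ℤ)) z)) := by
  induction z using laurentTensor_induction with
  | single k a l b =>
    have h1 : ∀ i : ℕ, mulMap (Algebra.ofId D₁ D₂) (residue D₁ D₂ n
        (conjT D₁ D₂ n (-(i : ℤ)) (tmul (laurentSub D₁ D₂ n).val (.single k a) (.single l b)))) =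
          if (n.natAbs : ℤ) ∣ k - i then (if k + l = 0 then a * b else 0) else 0 := by
      intro i
      have h2 : (l + - -(i : ℤ) = -(-(i : ℤ) + k)) ↔ k + l = 0 := by omega
      rw [conjT_apply, rmul_tmul, lmul_tmul, residue_tmul, T, T, AddMonoidAlgebra.single_mul_single,
        AddMonoidAlgebra.single_mul_single, one_mul, mul_one, residueBilin_single,
        AddMonoidAlgebra.coeff_single, Finsupp.single_apply]
      simp only [h2, Int.natAbs_dvd]
      simp only [neg_add_eq_sub]
      split_ifs
      · exact mulMap_tmul _ a b
      · exact (mulMap_tmul _ a 0).trans (mul_zero a)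
      · exact map_zero _
    simp only [h1]
    rw [sum_range_ite_dvd_sub (by omega), mulMap_tmul, AddMonoidAlgebra.single_mul_single,
      AddMonoidAlgebra.coeff_single, Finsupp.single_apply]
  | add z w hz hw =>
    simp only [map_add, AddMonoidAlgebra.coeff_add, Finsupp.add_apply, hz, hw,
      Finset.sum_add_distrib]

/-- For a separability idempotent `e` of `D₁[Tⁿ, T⁻ⁿ] ⊆ D₂[T, T⁻¹]`, the element `|n| • residue e`
is one of `D₁ ⊆ D₂`. -/
theorem isSeparableExt_of_laurentSub (hn : n ≠ 0)
    (h : IsSeparableExt (laurentSub D₁ D₂ n).val) :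
    IsSeparableExt (Algebra.ofId D₁ D₂) ∧ (n.natAbs : D₁) ≠ 0 := by
  obtain ⟨e, he⟩ := isSeparableExt_iff.1 h
  have hconj : ∀ j : ℤ, conjT D₁ D₂ n j e = e := fun j => by
    rw [conjT_apply, lmul_rmul, he.lmul_eq_rmul, ← rmul_mul, ← T_add, add_neg_cancel, T_zero,
      rmul_one]
  have h1 : (1 : D₂) = (n.natAbs : D₁) • mulMap (Algebra.ofId D₁ D₂) (residue D₁ D₂ n e) := by
    have := coeff_mulMap_eq_sum hn e
    simp only [hconj, he.mulMap_eq_one, Finset.sum_const, Finset.card_range] at this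
    rw [Nat.cast_smul_eq_nsmul, ← this]
    exact Finsupp.single_eq_same.symm
  refine ⟨isSeparableExt_iff.2 ⟨(n.natAbs : D₁) • residue D₁ D₂ n e, fun s => ?_, ?_⟩, fun h0 => ?_⟩
  · rw [map_smul, map_smul, ← residue_lmul_C, ← residue_rmul_C, he.lmul_eq_rmul]
  · rw [map_smul, ← h1]
  · rw [h0, zero_smul] at h1
    exact one_ne_zero h1

theorem isGradedSeparableExt_laurentSub_iff (m : ℤ) (hn : n ≠ 0) :
    IsGradedSeparableExt (laurentSub D₁ D₂ n).val (laurentGrading D₂ m) ↔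
      IsSeparableExt (Algebra.ofId D₁ D₂) ∧ IsUnit (n : D₁) := by
  have h0 : IsUnit (n : D₁) ↔ (n.natAbs : D₁) ≠ 0 := by
    rw [isUnit_iff_ne_zero]
    rcases n.natAbs_eq with h | h
    · nth_rewrite 1 [h]
      rw [Int.cast_natCast]
    · nth_rewrite 1 [h]
      rw [Int.cast_neg, Int.cast_natCast, neg_ne_zero]
  rw [h0]
  exact ⟨fun ⟨ρ, hρ, _⟩ => isSeparableExt_of_laurentSub hn ⟨ρ, hρ⟩,
    fun h => isGradedSeparableExt_laurentSub m h.1 h.2⟩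

end Laurent

end DGSep

theorem theorem3p4 {K : Type uK} [Field K] :
    -- extensions `φ : B → A` of graded commutative dg-division algebras over `K`
    (∀ {A : Type uA} [Ring A] [Algebra K A] {B : Type uB} [Ring B] [Algebra K B]
        (𝒜 : DGSep.DGStructure K A) (ℬ : DGSep.DGStructure K B) (φ : DGSep.DGExtension ℬ 𝒜),
        DGSep.IsGradedCommutative 𝒜.gr → 𝒜.IsDGDivision →
        DGSep.IsGradedCommutative ℬ.gr → ℬ.IsDGDivision →
        ((DGSep.IsGradedCommutative 𝒜.cyclesGr ∧ DGSep.IsGradedDivision 𝒜.cyclesGr) ∧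
          (DGSep.IsGradedCommutative ℬ.cyclesGr ∧ DGSep.IsGradedDivision ℬ.cyclesGr)) ∧
        (ℬ.IsAcyclic → 𝒜.IsAcyclic ∧
          (DGSep.IsGradedSeparableExt φ.cyclesMap 𝒜.cyclesGr → φ.IsDGSeparable) ∧
          (ringChar K ≠ 2 →
            (φ.IsDGSeparable ↔ DGSep.IsGradedSeparableExt φ.cyclesMap 𝒜.cyclesGr))) ∧
        (ringChar K ≠ 2 → ℬ.d = 0 → 𝒜.IsAcyclic → ¬ φ.IsDGSeparable)) ∧
    -- graded commutative graded-division algebras over `K`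
    (ringChar K ≠ 2 → ∀ {C : Type uC} [Ring C] [Algebra K C] (𝒞 : ℤ → Submodule K C)
        [GradedAlgebra 𝒞], DGSep.IsGradedCommutative 𝒞 → DGSep.IsGradedDivision 𝒞 →
        (IsField C ∧ 𝒞 0 = ⊤) ∨
        ∃ (D : Type uC) (_ : Field D) (_ : Algebra K D) (m : ℤ)
          (e : C ≃ₐ[K] LaurentPolynomial D), m ≠ 0 ∧ Even m ∧
            ∀ (k : ℤ) (x : C), x ∈ 𝒞 k ↔ e x ∈ DGSep.laurentGrading D m k) ∧
    -- the extensions `D₁[Tⁿ, T⁻ⁿ] ⊆ D₂[T, T⁻¹]` with `T` in degree `m`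
    (∀ {D₁ : Type u₁} {D₂ : Type u₂} [Field D₁] [Field D₂] [Algebra D₁ D₂] (m n : ℤ),
        m ≠ 0 → n ≠ 0 →
        (DGSep.IsGradedSeparableExt (DGSep.laurentSub D₁ D₂ n).val (DGSep.laurentGrading D₂ m) ↔
          DGSep.IsSeparableExt (Algebra.ofId D₁ D₂) ∧ IsUnit (n : D₁))) := by
  refine ⟨?_, fun h2 C _ _ 𝒞 _ hc hd =>
    DGSep.isField_or_exists_algEquiv_laurent 𝒞 hc hd h2,
    fun m n _ hn => DGSep.isGradedSeparableExt_laurentSub_iff m hn⟩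
  intro A _ _ B _ _ 𝒜 ℬ φ hcA hA hcB hB
  have := hA.nontrivial
  exact ⟨⟨⟨DGSep.DGStructure.isGradedCommutative_cyclesGr hcA, hA.isGradedDivision_cyclesGr hcA⟩,
      ⟨DGSep.DGStructure.isGradedCommutative_cyclesGr hcB, hB.isGradedDivision_cyclesGr hcB⟩⟩,
    fun hac => ⟨φ.isAcyclic hac, φ.isDGSeparable_of_isGradedSeparableExt hcA hac,
      fun h2 => ⟨φ.isGradedSeparableExt_of_isDGSeparable hcA h2 hac,
        φ.isDGSeparable_of_isGradedSeparableExt hcA hac⟩⟩,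
    fun h2 hdB hac => φ.not_isDGSeparable_of_d_eq_zero hcA h2 hdB hac⟩
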